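/- Let $\rho_1,\sigma_1$ be density matrices (positive semidefinite, trace one) on $\mathbb{C}^{d_1}$ and $\rho_2,\sigma_2$ density matrices on $\mathbb{C}^{d_2}$, with $\sigma_1$ and $\sigma_2$ invertible. Let $D(\rho\|\sigma)=\mathrm{tr}\,\rho(\log_2\rho-\log_2\sigma)$ be the relative entropy, and let $\Delta\in\{T,P\}$ be either the trace distance $T(\rho,\sigma)=\frac12\|\rho-\sigma\|_1$ or the purified distance $P(\rho,\sigma)=\sqrt{1-\|\sqrt\rho\sqrt\sigma\|_1^2}$. For integers $n\ge 1$, $m\ge 0$ and for $\varepsilon\in(0,1)$, call $(n,m,\varepsilon)$ achievable if there is a completely positive trace-preserving linear map $\mathcal{E}$ with $$\mathcal{E}(\sigma_1^{\otimes n})=\sigma_2^{\otimes m}\quad\text{and}\quad \Delta\big(\mathcal{E}(\rho_1^{\otimes n}),\rho_2^{\otimes m}\big)\le\varepsilon,$$ and let $\hat R^{\varepsilon,\Delta}(n)=\sup\{m/n : (n,m,\varepsilon)\text{ is achievable}\}\in[0,\infty]$. Then for every $\varepsilon\in(0,1)$ and each $\Delta\in\{T,P\}$: if $D(\rho_2\|\sigma_2)\ne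 0$, the supremum is a (finite) maximum for every $n\ge1$, and $$\lim_{n\to\infty}\hat R^{\varepsilon,\Delta}(n)=\frac{D(\rho_1\|\sigma_1)}{D(\rho_2\|\sigma_2)};$$ if $D(\rho_2\|\sigma_2)=0$, then $\hat R^{\varepsilon,\Delta}(n)=\infty$ for every $n\ge 1$. -/

import Mathlib

open Filter Topology
open scoped ComplexOrder

namespace QDichotomy

/-- Quantum states: positive semidefinite matrices of trace one. -/
def IsState {ι : Type*} [Fintype ι] (ρ : Matrix ι ι ℂ) : Prop :=
  ρ.PosSemidef ∧ ρ.trace = 1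

/-- The `n`-fold tensor power `ρ^{⊗ n}`, a matrix indexed by the product basis
`e_{i 0} ⊗ ⋯ ⊗ e_{i (n-1)}`; for `n = 0` it is the `1 × 1` identity. -/
def tensorPower {ι : Type*} (ρ : Matrix ι ι ℂ) (n : ℕ) : Matrix (Fin n → ι) (Fin n → ι) ℂ :=
  Matrix.of fun i j => ∏ k, ρ (i k) (j k)

/-- The ampliation `Φ ⊗ id_k` of a linear map `Φ` between matrix algebras. -/
def ampliation {ι κ : Type*} (Φ : Matrix ι ι ℂ →ₗ[ℂ] Matrix κ κ ℂ) (k : ℕ)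
    (X : Matrix (ι × Fin k) (ι × Fin k) ℂ) : Matrix (κ × Fin k) (κ × Fin k) ℂ :=
  Matrix.of fun a b => Φ (Matrix.of fun i j => X (i, a.2) (j, b.2)) a.1 b.1

/-- Quantum channels: completely positive trace-preserving linear maps. -/
structure IsChannel {ι κ : Type*} [Fintype ι] [Fintype κ]
    (Φ : Matrix ι ι ℂ →ₗ[ℂ] Matrix κ κ ℂ) : Prop where
  completely_positive : ∀ (k : ℕ) (X : Matrix (ι × Fin k) (ι × Fin k) ℂ),
    X.PosSemidef → (ampliation Φ k X).PosSemidef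
  trace_preserving : ∀ X : Matrix ι ι ℂ, (Φ X).trace = X.trace

variable {ι κ : Type*} [Fintype ι] [DecidableEq ι] [Fintype κ] [DecidableEq κ]

/-- The Schatten 1-norm `‖X‖₁ = tr √(X† X)`. -/
noncomputable def traceNorm (X : Matrix ι ι ℂ) : ℝ :=
  (cfc Real.sqrt (X.conjTranspose * X)).trace.re

/-- The trace distance `T(ρ, σ) = ½ ‖ρ - σ‖₁`. -/
noncomputable def traceDistance (ρ σ : Matrix ι ι ℂ) : ℝ :=
  (1 / 2 : ℝ) * traceNorm (ρ - σ)

/-- The fidelity `F(ρ, σ) = ‖√ρ √σ‖₁²`. -/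
noncomputable def fidelity (ρ σ : Matrix ι ι ℂ) : ℝ :=
  traceNorm (cfc Real.sqrt ρ * cfc Real.sqrt σ) ^ 2

/-- The purified distance `P(ρ, σ) = √(1 - F(ρ, σ))`. -/
noncomputable def purifiedDistance (ρ σ : Matrix ι ι ℂ) : ℝ :=
  Real.sqrt (1 - fidelity ρ σ)

/-- The two choices of error metric. -/
inductive ErrorMetric
  | trace
  | purified

/-- The distance `Δ(ρ, σ)` for `Δ ∈ {T, P}`. -/
noncomputable def ErrorMetric.distance (Δ : ErrorMetric) (ρ σ : Matrix ι ι ℂ) : ℝ :=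
  match Δ with
  | .trace => traceDistance ρ σ
  | .purified => purifiedDistance ρ σ

/-- The quantum relative entropy `D(ρ‖σ) = tr ρ (log ρ - log σ)`, with logarithm to base 2,
for a state `ρ` and a state `σ` of full support (the only case where it is used, so the value
is always finite). The convention `Real.logb 2 0 = 0` implements `0 log 0 = 0` for `ρ`. -/
noncomputable def relativeEntropy (ρ σ : Matrix ι ι ℂ) : ℝ :=
  (ρ * (cfc (Real.logb 2) ρ - cfc (Real.logb 2) σ)).trace.re

/-- The triplet `(n, m, ε)` is achievable for the transformation of `(ρ₁, σ₁)` into `(ρ₂, σ₂)`: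
some channel maps `σ₁^{⊗ n}` exactly to `σ₂^{⊗ m}` and `ρ₁^{⊗ n}` to within error `ε` of
`ρ₂^{⊗ m}`. -/
def Achievable (Δ : ErrorMetric) (ρ₁ σ₁ : Matrix ι ι ℂ) (ρ₂ σ₂ : Matrix κ κ ℂ)
    (n m : ℕ) (ε : ℝ) : Prop :=
  ∃ Φ : Matrix (Fin n → ι) (Fin n → ι) ℂ →ₗ[ℂ] Matrix (Fin m → κ) (Fin m → κ) ℂ,
    IsChannel Φ ∧ Φ (tensorPower σ₁ n) = tensorPower σ₂ m ∧
      Δ.distance (Φ (tensorPower ρ₁ n)) (tensorPower ρ₂ m) ≤ ε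

/-- The set of rates `m / n` that are achievable with error `ε` on input block length `n`. -/
def achievableRates (Δ : ErrorMetric) (ρ₁ σ₁ : Matrix ι ι ℂ) (ρ₂ σ₂ : Matrix κ κ ℂ)
    (ε : ℝ) (n : ℕ) : Set EReal :=
  {r | ∃ m : ℕ, Achievable Δ ρ₁ σ₁ ρ₂ σ₂ n m ε ∧ r = (((m : ℝ) / (n : ℝ) : ℝ) : EReal)}

/-- The maximal rate `R̂(n)`, as a supremum of extended real numbers: it is `∞` if the achievable
rates are unbounded. -/
noncomputable def maxRate (Δ : ErrorMetric) (ρ₁ σ₁ : Matrix ι ι ℂ) (ρ₂ σ₂ : Matrix κ κ ℂ)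
    (ε : ℝ) (n : ℕ) : EReal :=
  sSup (achievableRates Δ ρ₁ σ₁ ρ₂ σ₂ ε n)

end QDichotomy

/-! Everything passes through hypothesis testing. For $D=D(\rho\|\sigma)$, Stein's lemma gives tests
accepting $\rho^{\otimes n}$ almost surely and $\sigma^{\otimes n}$ with probability about $2^{-nD}$
(`eventually_exists_test`). Dually, $\rho^{\otimes n}$ is close to a state dominated by about
$2^{nD}\sigma^{\otimes n}$ (`eventually_exists_smoothing`). Both come from sandwiching the typical
projections of $\rho^{\otimes n}$ and $\sigma^{\otimes n}$, which need not commute; gentle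
measurement controls the disturbance.

Achievability (`achievable_of_test`): test the input and, on acceptance, prepare the smoothed target
$\omega$. The state prepared on rejection is then fixed by requiring the image of $\sigma_1^{\otimes
n}$ to be exact. It is positive when the type II error times the domination constant is at most $1$,
that is, roughly when $mD_2\le nD_1$.

Strong converse (`accept_le_of_achievable`): a test separating $\rho_2^{\otimes m}$ from
$\sigma_2^{\otimes m}$, pulled back through the channel, would accept the smoothed $\rho_1^{\otimes
n}$ with probability at most about $2^{nD_1-mD_2}$. By `exists_accept_of_distance_le` the error
bound forces acceptance at least $c>0$, with $c$ depending only on $\varepsilon$ and the metric.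
This excludes rates above $D_1/D_2$ for every $\varepsilon<1$. Klein's inequality with its equality
case settles $D_2=0$. -/

namespace QDichotomy

open scoped MatrixOrder
open Matrix

/-! ### Hilbert–Schmidt geometry and the Loewner order. -/

section HilbertSchmidt

variable {l m n : Type*}

/-- The entries of a matrix as a vector of the Euclidean space. -/
noncomputable def hsVec (A : Matrix m n ℂ) : EuclideanSpace ℂ (m × n) :=
  WithLp.toLp 2 fun p => A p.1 p.2

theorem hsVec_add (A B : Matrix m n ℂ) : hsVec (A + B) = hsVec A + hsVec B := rfl

theorem hsVec_sub (A B : Matrix m n ℂ) : hsVec (A - B) = hsVec A - hsVec B := rfl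

theorem hsVec_smul (c : ℂ) (A : Matrix m n ℂ) : hsVec (c • A) = c • hsVec A := rfl

variable [Fintype l] [Fintype m] [Fintype n]

/-- The Hilbert–Schmidt norm `√(tr A† A)` of a rectangular matrix. -/
noncomputable def hsNorm (A : Matrix m n ℂ) : ℝ := ‖hsVec A‖

theorem hsNorm_nonneg (A : Matrix m n ℂ) : 0 ≤ hsNorm A := norm_nonneg _

theorem inner_hsVec (A B : Matrix m n ℂ) :
    inner ℂ (hsVec A) (hsVec B) = (Aᴴ * B).trace := by
  simp only [hsVec, PiLp.inner_apply, Fintype.sum_prod_type, trace, diag_apply, mul_apply,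
    conjTranspose_apply]
  rw [Finset.sum_comm]
  simp [mul_comm]

theorem hsNorm_sq (A : Matrix m n ℂ) : hsNorm A ^ 2 = (Aᴴ * A).trace.re := by
  rw [← inner_hsVec, hsNorm, ← inner_self_eq_norm_sq (𝕜 := ℂ)]
  rfl

theorem norm_trace_le (A B : Matrix m n ℂ) : ‖(Aᴴ * B).trace‖ ≤ hsNorm A * hsNorm B := by
  rw [← inner_hsVec]
  exact norm_inner_le_norm _ _

theorem hsNorm_add_le (A B : Matrix m n ℂ) : hsNorm (A + B) ≤ hsNorm A + hsNorm B := by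
  rw [hsNorm, hsVec_add]
  exact norm_add_le _ _

theorem hsNorm_sub_rev (A B : Matrix m n ℂ) : hsNorm (A - B) = hsNorm (B - A) := by
  rw [hsNorm, hsVec_sub, norm_sub_rev, ← hsVec_sub, ← hsNorm]

theorem hsNorm_le_add_sub (A B : Matrix m n ℂ) : hsNorm A ≤ hsNorm B + hsNorm (A - B) := by
  simpa using hsNorm_add_le B (A - B)

theorem hsNorm_smul (c : ℂ) (A : Matrix m n ℂ) : hsNorm (c • A) = ‖c‖ * hsNorm A := by
  rw [hsNorm, hsVec_smul, norm_smul, ← hsNorm]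

theorem hsNorm_conjTranspose (A : Matrix m n ℂ) : hsNorm Aᴴ = hsNorm A := by
  have h : hsNorm Aᴴ ^ 2 = hsNorm A ^ 2 := by
    rw [hsNorm_sq, hsNorm_sq, conjTranspose_conjTranspose, trace_mul_comm]
  exact (pow_left_inj₀ (hsNorm_nonneg _) (hsNorm_nonneg _) two_ne_zero).1 h

theorem hsNorm_sq' (A : Matrix m n ℂ) : hsNorm A ^ 2 = (A * Aᴴ).trace.re := by
  rw [hsNorm_sq, trace_mul_comm]

theorem hsNorm_sub_sq (A B : Matrix m n ℂ) :
    hsNorm (A - B) ^ 2 = hsNorm A ^ 2 - 2 * (Aᴴ * B).trace.re + hsNorm B ^ 2 := by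
  rw [hsNorm, hsVec_sub, ← inner_hsVec, norm_sub_sq (𝕜 := ℂ)]
  rfl

theorem self_mul_conjTranspose_nonneg (A : Matrix m n ℂ) : 0 ≤ A * Aᴴ :=
  nonneg_iff_posSemidef.2 (posSemidef_self_mul_conjTranspose A)

theorem conj_le_conj {A B : Matrix m m ℂ} (h : A ≤ B) (C : Matrix n m ℂ) :
    C * A * Cᴴ ≤ C * B * Cᴴ := by
  have := (le_iff.1 h).mul_mul_conjTranspose_same C
  rw [le_iff]
  rwa [Matrix.mul_sub, Matrix.sub_mul] at this

theorem trace_re_nonneg {A : Matrix m m ℂ} (h : 0 ≤ A) : 0 ≤ A.trace.re :=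
  (Complex.le_def.1 (nonneg_iff_posSemidef.1 h).trace_nonneg).1

theorem trace_re_mono {A B : Matrix m m ℂ} (h : A ≤ B) : A.trace.re ≤ B.trace.re := by
  have := trace_re_nonneg (sub_nonneg.2 h)
  rw [trace_sub, Complex.sub_re] at this
  linarith

theorem exists_eq_mul_conjTranspose [DecidableEq m] {A : Matrix m m ℂ} (h : 0 ≤ A) :
    ∃ L : Matrix m m ℂ, A = L * Lᴴ := by
  obtain ⟨B, hB⟩ := CStarAlgebra.nonneg_iff_eq_mul_star_self.1 h
  exact ⟨B, hB⟩

theorem trace_mul_nonneg [DecidableEq m] {A B : Matrix m m ℂ} (hA : 0 ≤ A) (hB : 0 ≤ B) :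
    0 ≤ (A * B).trace.re := by
  obtain ⟨L, rfl⟩ := exists_eq_mul_conjTranspose hB
  rw [← Matrix.mul_assoc, trace_mul_comm, ← Matrix.mul_assoc]
  have := conj_le_conj hA Lᴴ
  rw [conjTranspose_conjTranspose] at this
  exact trace_re_nonneg (by simpa using this)

theorem trace_mul_mono [DecidableEq m] {A B C : Matrix m m ℂ} (hA : 0 ≤ A) (hB : B ≤ C) :
    (A * B).trace.re ≤ (A * C).trace.re := by
  have := trace_mul_nonneg hA (sub_nonneg.2 hB)
  rw [Matrix.mul_sub, trace_sub, Complex.sub_re] at this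
  linarith

theorem hsNorm_mul_le [DecidableEq n] (A : Matrix m n ℂ) {V : Matrix n l ℂ} (hV : V * Vᴴ ≤ 1) :
    hsNorm (A * V) ≤ hsNorm A := by
  refine (pow_le_pow_iff_left₀ (hsNorm_nonneg _) (hsNorm_nonneg _) two_ne_zero).1 ?_
  rw [hsNorm_sq', hsNorm_sq']
  have := trace_re_mono (conj_le_conj hV A)
  rw [Matrix.mul_one] at this
  simpa [Matrix.mul_assoc, conjTranspose_mul] using this

theorem hsNorm_conjTranspose_mul_le [DecidableEq n] {V : Matrix n l ℂ} (hV : V * Vᴴ ≤ 1)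
    (A : Matrix n m ℂ) : hsNorm (Vᴴ * A) ≤ hsNorm A := by
  rw [← hsNorm_conjTranspose A, ← hsNorm_conjTranspose (Vᴴ * A)]
  simpa using hsNorm_mul_le Aᴴ hV

theorem conjTranspose_mul_self_le_one [DecidableEq m] [DecidableEq n] {V : Matrix m n ℂ}
    (hV : V * Vᴴ ≤ 1) : Vᴴ * V ≤ 1 := by
  have a := conj_le_conj hV Vᴴ
  rw [conjTranspose_conjTranspose, Matrix.mul_one] at a
  have b := self_mul_conjTranspose_nonneg (1 - Vᴴ * V)
  have hh : (1 - Vᴴ * V)ᴴ = 1 - Vᴴ * V := by simp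
  rw [hh] at b
  -- A square of a Hermitian matrix plus the conjugate by $V^\dagger$ of $1-VV^\dagger\ge0$.
  have : 1 - Vᴴ * V = (1 - Vᴴ * V) * (1 - Vᴴ * V) + (Vᴴ * V - Vᴴ * (V * Vᴴ) * V) := by
    simp only [Matrix.mul_sub, Matrix.sub_mul, Matrix.mul_one, Matrix.one_mul, Matrix.mul_assoc]
    abel
  rw [← sub_nonneg, this]
  exact add_nonneg b (sub_nonneg.2 a)

end HilbertSchmidt

/-! ### Square roots, polar decomposition and trace-norm duality. -/

section SqrtPolar

variable {m n : Type*} [Fintype m] [DecidableEq m] [Fintype n]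

theorem cfc_sqrt_nonneg (A : Matrix m m ℂ) : 0 ≤ cfc Real.sqrt A :=
  cfc_nonneg fun _ _ => Real.sqrt_nonneg _

theorem cfc_isHermitian (f : ℝ → ℝ) (A : Matrix m m ℂ) : (cfc f A)ᴴ = cfc f A :=
  (cfc_predicate f A : IsSelfAdjoint _)

theorem continuousOn_spectrum (f : ℝ → ℝ) (A : Matrix m m ℂ) : ContinuousOn f (spectrum ℝ A) :=
  A.finite_real_spectrum.continuousOn f

theorem cfc_sqrt_mul_self {A : Matrix m m ℂ} (hA : 0 ≤ A) :
    cfc Real.sqrt A * cfc Real.sqrt A = A := by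
  rw [← cfc_mul _ _ _ (continuousOn_spectrum _ _) (continuousOn_spectrum _ _)]
  conv_rhs => rw [← cfc_id ℝ A (IsSelfAdjoint.of_nonneg hA)]
  exact cfc_congr fun x hx => Real.mul_self_sqrt (spectrum_nonneg_of_nonneg hA hx)

/-- Polar decomposition with a contraction. -/
theorem exists_polar (X : Matrix m n ℂ) : ∃ V : Matrix m n ℂ, V * Vᴴ ≤ 1 ∧
    X = cfc Real.sqrt (X * Xᴴ) * V ∧ V * Xᴴ = cfc Real.sqrt (X * Xᴴ) := by
  set A := X * Xᴴ with hAdef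
  have hA : 0 ≤ A := self_mul_conjTranspose_nonneg X
  have hs : ∀ x ∈ spectrum ℝ A, 0 ≤ x := fun x hx => spectrum_nonneg_of_nonneg hA hx
  -- Since `0⁻¹ = 0`, this is the pseudo-inverse of the square root, so $X$ need not be invertible.
  set g : ℝ → ℝ := fun x => (Real.sqrt x)⁻¹
  have hid : cfc (fun x : ℝ => x) A = A := cfc_id' ℝ A (IsSelfAdjoint.of_nonneg hA)
  have hgA : cfc g A * A = cfc Real.sqrt A := by
    nth_rewrite 2 [← hid]
    rw [← cfc_mul _ _ _ (continuousOn_spectrum _ _) (continuousOn_spectrum _ _)]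
    refine cfc_congr fun x hx => ?_
    have h0 := hs x hx
    rcases h0.eq_or_lt with h | h
    · simp [g, ← h]
    · have := Real.sqrt_pos.2 h
      simp only [g]
      nth_rewrite 2 [← Real.mul_self_sqrt h0]
      field_simp
  set p := cfc Real.sqrt A * cfc g A with hp
  have hp' : p = cfc (fun x => Real.sqrt x * g x) A :=
    (cfc_mul _ _ _ (continuousOn_spectrum _ _) (continuousOn_spectrum _ _)).symm
  have hpA : p * A = A := by
    rw [hp, Matrix.mul_assoc, hgA, cfc_sqrt_mul_self hA]
  have hph : pᴴ = p := by rw [hp']; exact cfc_isHermitian _ _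
  have hp1 : p ≤ 1 := by
    rw [hp']
    refine cfc_le_one _ _ fun x hx => ?_
    simp only [g]
    exact mul_inv_le_one
  refine ⟨cfc g A * X, ?_, ?_, ?_⟩
  · rw [conjTranspose_mul, cfc_isHermitian, ← Matrix.mul_assoc, Matrix.mul_assoc _ X, ← hAdef, hgA]
    exact hp1
  · rw [← Matrix.mul_assoc, ← hp]
    -- The support projection $p$ of $XX^\dagger$ fixes $X$, because the defect has zero square.
    have h0 : (X - p * X) * (X - p * X)ᴴ = 0 := by
      rw [conjTranspose_sub, conjTranspose_mul, hph, Matrix.sub_mul, Matrix.mul_sub, Matrix.mul_sub,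
        ← Matrix.mul_assoc X, ← hAdef, Matrix.mul_assoc p X, ← hAdef, hpA, Matrix.mul_assoc p X,
        ← Matrix.mul_assoc X, ← hAdef, ← Matrix.mul_assoc p, hpA, sub_self]
    exact sub_eq_zero.1 (self_mul_conjTranspose_eq_zero.1 h0)
  · rw [Matrix.mul_assoc, ← hAdef, hgA]

theorem traceNorm_nonneg (X : Matrix m m ℂ) : 0 ≤ traceNorm X :=
  trace_re_nonneg (cfc_sqrt_nonneg _)

/-- The contraction in the polar decomposition of $X^\dagger$ attains the dual formula for the trace
norm. -/
theorem exists_trace_mul_eq_traceNorm (X : Matrix m m ℂ) :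
    ∃ V : Matrix m m ℂ, V * Vᴴ ≤ 1 ∧ (V * X).trace.re = traceNorm X := by
  obtain ⟨V, hV, -, h⟩ := exists_polar Xᴴ
  refine ⟨V, hV, ?_⟩
  rw [conjTranspose_conjTranspose] at h
  rw [h, traceNorm]

/-- Hölder's inequality between the trace norm and a product of two contractions. -/
theorem norm_trace_mul_le_traceNorm (X : Matrix m m ℂ) {V W : Matrix m n ℂ} (hV : V * Vᴴ ≤ 1)
    (hW : W * Wᴴ ≤ 1) : ‖(X * (V * Wᴴ)).trace‖ ≤ traceNorm X := by
  obtain ⟨U, hU, hX, -⟩ := exists_polar Xᴴ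
  rw [conjTranspose_conjTranspose] at hX
  set N := cfc Real.sqrt (Xᴴ * X) with hN
  have hN0 : 0 ≤ N := cfc_sqrt_nonneg _
  set s := cfc Real.sqrt N with hs
  have hss : s * s = N := cfc_sqrt_mul_self hN0
  have hsh : sᴴ = s := cfc_isHermitian _ _
  have hX' : X = Uᴴ * N := by
    rw [← conjTranspose_conjTranspose X, hX, conjTranspose_mul, cfc_isHermitian]
  -- Splitting $|X|=s^2$ between the two factors lets Cauchy–Schwarz give $\|s\|_2^2=\|X\|_1$.
  have : (X * (V * Wᴴ)).trace = ((s * U * W)ᴴ * (s * V)).trace := by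
    rw [hX', ← hss, ← Matrix.mul_assoc, trace_mul_comm, conjTranspose_mul, conjTranspose_mul, hsh]
    simp only [Matrix.mul_assoc]
  rw [this]
  have hn : hsNorm s ^ 2 = traceNorm X := by rw [hsNorm_sq, hsh, hss, traceNorm]
  refine (norm_trace_le _ _).trans ?_
  rw [← hn, sq]
  exact mul_le_mul ((hsNorm_mul_le _ hW).trans (hsNorm_mul_le _ hU)) (hsNorm_mul_le _ hV)
    (hsNorm_nonneg _) (hsNorm_nonneg _)

end SqrtPolar

/-! ### The two error metrics, controlled by purifications and tests. -/

section Distance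

variable {m n : Type*} [Fintype m] [Fintype n]

theorem IsState.nonneg {ρ : Matrix m m ℂ} (h : IsState ρ) : 0 ≤ ρ := nonneg_iff_posSemidef.2 h.1

theorem IsState.hsNorm_eq_one {K : Matrix m n ℂ} (h : IsState (K * Kᴴ)) : hsNorm K = 1 := by
  have h1 : hsNorm K ^ 2 = 1 := by rw [hsNorm_sq', h.2, Complex.one_re]
  exact (pow_eq_one_iff_of_nonneg (hsNorm_nonneg _) two_ne_zero).1 h1

theorem fromCols_mul_conjTranspose {a b c : Type*} [Fintype b] [Fintype c] (A : Matrix a b ℂ)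
    (B : Matrix a c ℂ) :
    fromCols A B * (fromCols A B)ᴴ = A * Aᴴ + B * Bᴴ := by
  rw [conjTranspose_fromCols_eq_fromRows_conjTranspose, fromCols_mul_fromRows]

variable [DecidableEq m]

/-- Both distances between states are bounded by the distance between purifications. -/
theorem distance_le_hsNorm_sub (Δ : ErrorMetric) {K L : Matrix m n ℂ} (hK : IsState (K * Kᴴ))
    (hL : IsState (L * Lᴴ)) : Δ.distance (K * Kᴴ) (L * Lᴴ) ≤ hsNorm (K - L) := by
  have hK1 := hK.hsNorm_eq_one
  have hL1 := hL.hsNorm_eq_one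
  have h0 := hsNorm_nonneg (K - L)
  cases Δ with
  | trace =>
    change (1 / 2 : ℝ) * traceNorm _ ≤ _
    obtain ⟨V, hV, h⟩ := exists_trace_mul_eq_traceNorm (K * Kᴴ - L * Lᴴ)
    have hdec : K * Kᴴ - L * Lᴴ = (K - L) * Kᴴ + L * (K - L)ᴴ := by
      rw [conjTranspose_sub, Matrix.sub_mul, Matrix.mul_sub]
      abel
    have h1 : (V * ((K - L) * Kᴴ)).trace = ((Vᴴ * K)ᴴ * (K - L)).trace := by
      rw [conjTranspose_mul, conjTranspose_conjTranspose, ← Matrix.mul_assoc, trace_mul_comm,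
        Matrix.mul_assoc]
    have h2 : (V * (L * (K - L)ᴴ)).trace = ((Vᴴ * (K - L))ᴴ * L).trace := by
      rw [conjTranspose_mul, conjTranspose_conjTranspose, ← Matrix.mul_assoc, trace_mul_comm,
        Matrix.mul_assoc]
    rw [← h, hdec, Matrix.mul_add, trace_add, Complex.add_re, h1, h2]
    have b1 := (Complex.re_le_norm _).trans (norm_trace_le (Vᴴ * K) (K - L))
    have b2 := (Complex.re_le_norm _).trans (norm_trace_le (Vᴴ * (K - L)) L)
    have c1 := mul_le_mul_of_nonneg_right (hsNorm_conjTranspose_mul_le hV K) h0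
    have c2 := hsNorm_conjTranspose_mul_le hV (K - L)
    rw [hK1] at c1
    rw [hL1] at b2
    linarith
  | purified =>
    change Real.sqrt (1 - fidelity _ _) ≤ _
    obtain ⟨V, hV, hVK, -⟩ := exists_polar K
    obtain ⟨W, hW, hWL, -⟩ := exists_polar L
    rw [fidelity]
    set t := traceNorm (cfc Real.sqrt (K * Kᴴ) * cfc Real.sqrt (L * Lᴴ)) with ht
    have h1 : (Kᴴ * L).trace.re ≤ t := by
      have := (Complex.re_le_norm _).trans
        (norm_trace_mul_le_traceNorm (cfc Real.sqrt (K * Kᴴ) * cfc Real.sqrt (L * Lᴴ)) hW hV)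
      rw [← ht, ← Matrix.mul_assoc, trace_mul_comm, Matrix.mul_assoc, ← hWL, ← Matrix.mul_assoc] at this
      have hKh : Kᴴ = Vᴴ * cfc Real.sqrt (K * Kᴴ) := by
        conv_lhs => rw [hVK]
        rw [conjTranspose_mul, cfc_isHermitian]
      rwa [← hKh] at this
    have h2 := hsNorm_sub_sq K L
    rw [hK1, hL1] at h2
    refine Real.sqrt_le_iff.2 ⟨h0, ?_⟩
    -- Here $1-t^2\le 2-2t\le\|K-L\|_2^2$.
    nlinarith [sq_nonneg (t - 1)]

/-- If the subnormalized `K K†` is dominated by the state `ω` and `K` is close to a purification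
of `ρ`, then `ω` is close to `ρ`. -/
theorem distance_le_of_dominates (Δ : ErrorMetric) {ω ρ : Matrix m m ℂ} (hω : IsState ω)
    (hρ : IsState ρ) {K L : Matrix m n ℂ} (hK : K * Kᴴ ≤ ω) (hL : L * Lᴴ = ρ)
    (h1 : hsNorm (K - L) ≤ 1) : Δ.distance ω ρ ≤ Real.sqrt (2 * hsNorm (K - L)) := by
  -- Extra columns $S$ complete $K$ to a purification of $\omega$, while $L$ is padded by zeros.
  -- With $x=\|K-L\|_2$ the squared distance is $x^2+1-\|K\|_2^2\le x^2+1-(1-x)^2=2x$.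
  obtain ⟨S, hS⟩ := exists_eq_mul_conjTranspose (sub_nonneg.2 hK)
  have hω' : fromCols K S * (fromCols K S)ᴴ = ω := by
    rw [fromCols_mul_conjTranspose, ← hS]
    abel
  have hρ' : fromCols L (0 : Matrix m m ℂ) * (fromCols L (0 : Matrix m m ℂ))ᴴ = ρ := by
    rw [fromCols_mul_conjTranspose, hL, Matrix.zero_mul, add_zero]
  have hL1 : hsNorm L = 1 := IsState.hsNorm_eq_one (by rwa [hL])
  rw [← hω', ← hρ']
  refine (distance_le_hsNorm_sub Δ (by rwa [hω']) (by rwa [hρ'])).trans ?_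
  refine Real.le_sqrt_of_sq_le ?_
  have hsub : fromCols K S - fromCols L (0 : Matrix m m ℂ) = fromCols (K - L) S := by
    ext i (j | j) <;> simp
  have hn : hsNorm (fromCols K S - fromCols L (0 : Matrix m m ℂ)) ^ 2 = hsNorm (K - L) ^ 2 + (1 - hsNorm K ^ 2) := by
    rw [hsub, hsNorm_sq' (fromCols _ _), fromCols_mul_conjTranspose, trace_add, Complex.add_re, ← hsNorm_sq', ← hS,
      trace_sub, Complex.sub_re, hω.2, ← hsNorm_sq', Complex.one_re]
  rw [hn]
  have h2 := hsNorm_le_add_sub L K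
  rw [hsNorm_sub_rev, hL1] at h2
  nlinarith [hsNorm_nonneg K, hsNorm_nonneg (K - L)]

theorem distance_self (Δ : ErrorMetric) {ρ : Matrix m m ℂ} (hρ : IsState ρ) :
    Δ.distance ρ ρ ≤ 0 := by
  obtain ⟨L, rfl⟩ := exists_eq_mul_conjTranspose hρ.nonneg
  have := distance_le_hsNorm_sub Δ hρ hρ
  rwa [hsNorm, hsVec_sub, sub_self, norm_zero] at this

/-- A test which accepts `ρ` with probability near one accepts any `ω` that is not too far from
`ρ` with probability bounded away from zero. -/
theorem exists_accept_of_distance_le (Δ : ErrorMetric) {ε : ℝ} (hε₀ : 0 < ε) (hε₁ : ε < 1) :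
    ∃ c > 0, ∃ η > 0, ∀ (k : ℕ) {κ : Type} [Fintype κ] [DecidableEq κ]
      (ω ρ Q : Matrix (Fin k → κ) (Fin k → κ) ℂ), IsState ω → IsState ρ → Δ.distance ω ρ ≤ ε →
      0 ≤ Q → Q ≤ 1 → 1 - η ≤ (Q * ρ).trace.re → c ≤ (Q * ω).trace.re := by
  cases Δ with
  | trace =>
    refine ⟨(1 - ε) / 2, by linarith, (1 - ε) / 2, by linarith, ?_⟩
    intro k κ _ _ ω ρ Q hω hρ hd hQ0 hQ1 hQ
    change (1 / 2 : ℝ) * traceNorm _ ≤ _ at hd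
    have hQh : Qᴴ = Q := IsSelfAdjoint.of_nonneg hQ0
    have hQQ : Q * Q ≤ Q := by
      have a := conj_le_conj hQ1 Q
      have b := conj_le_conj hQ0 (1 - Q)
      rw [hQh, Matrix.mul_one] at a
      rw [conjTranspose_sub, conjTranspose_one, hQh, Matrix.mul_zero, Matrix.zero_mul] at b
      have : Q - Q * Q = (Q * Q - Q * Q * Q) + (1 - Q) * Q * (1 - Q) := by noncomm_ring
      rw [← sub_nonneg, this]
      exact add_nonneg (sub_nonneg.2 a) b
    -- Hölder with this contraction bounds the difference of the acceptance probabilities by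
    -- $\varepsilon$.
    set V := 1 - (2 : ℂ) • Q with hVdef
    have hVh : Vᴴ = V := by simp [hVdef, hQh]
    have hV : V * Vᴴ ≤ 1 := by
      rw [hVh]
      have : V * V = 1 - (4 : ℂ) • (Q - Q * Q) := by
        simp only [hVdef, Matrix.mul_sub, Matrix.sub_mul, Matrix.mul_one, Matrix.one_mul,
          Matrix.smul_mul, Matrix.mul_smul, smul_smul, smul_sub]
        module
      rw [this]
      exact sub_le_self _ (nonneg_iff_posSemidef.2
        ((le_iff.1 hQQ).smul (by norm_num)))
    have h1 : (1 : Matrix (Fin k → κ) (Fin k → κ) ℂ) * 1ᴴ ≤ 1 := by simp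
    have := (Complex.re_le_norm _).trans (norm_trace_mul_le_traceNorm (ω - ρ) hV h1)
    have he : ((ω - ρ) * (V * 1ᴴ)).trace = -2 * ((Q * ω).trace - (Q * ρ).trace) := by
      rw [conjTranspose_one, Matrix.mul_one, hVdef, Matrix.mul_sub, Matrix.mul_one, Matrix.mul_smul,
        trace_sub, trace_smul, trace_mul_comm, trace_sub, hω.2, hρ.2, Matrix.mul_sub, trace_sub]
      simp
    rw [he] at this
    simp at this
    linarith
  | purified =>
    set s := Real.sqrt (1 - ε ^ 2) with hs
    have hs0 : 0 < s := Real.sqrt_pos.2 (by nlinarith)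
    refine ⟨s ^ 2 / 4, by positivity, s ^ 2 / 4, by positivity, ?_⟩
    intro k κ _ _ ω ρ Q hω hρ hd hQ0 hQ1 hQ
    change Real.sqrt (1 - fidelity _ _) ≤ _ at hd
    have hF : s ≤ traceNorm (cfc Real.sqrt ω * cfc Real.sqrt ρ) := by
      have := (Real.sqrt_le_iff.1 hd).2
      rw [fidelity] at this
      exact (Real.sqrt_le_sqrt (by linarith)).trans (Real.sqrt_sq (traceNorm_nonneg _)).le
    obtain ⟨V, hV, hVeq⟩ := exists_trace_mul_eq_traceNorm (cfc Real.sqrt ω * cfc Real.sqrt ρ)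
    rw [← hVeq] at hF
    -- Applied to $Q$ and $1-Q$, this bounds the root fidelity by that of the two outcome
    -- distributions. The rejection term is at most $s/2$, so acceptance must supply the other
    -- $s/2$.
    have key : ∀ E : Matrix (Fin k → κ) (Fin k → κ) ℂ, 0 ≤ E → E ≤ 1 →
        (V * (cfc Real.sqrt ω * E * cfc Real.sqrt ρ)).trace.re ≤
          Real.sqrt (E * ω).trace.re * Real.sqrt (E * ρ).trace.re := by
      intro E hE0 hE1
      obtain ⟨L, rfl⟩ := exists_eq_mul_conjTranspose hE0
      have hn : ∀ τ : Matrix (Fin k → κ) (Fin k → κ) ℂ, 0 ≤ τ →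
          hsNorm (Lᴴ * cfc Real.sqrt τ) = Real.sqrt (L * Lᴴ * τ).trace.re := by
        intro τ hτ
        rw [← Real.sqrt_sq (hsNorm_nonneg _), hsNorm_sq', conjTranspose_mul, cfc_isHermitian,
          conjTranspose_conjTranspose, ← Matrix.mul_assoc, Matrix.mul_assoc Lᴴ, cfc_sqrt_mul_self hτ,
          trace_mul_comm, ← Matrix.mul_assoc]
      have he : (V * (cfc Real.sqrt ω * (L * Lᴴ) * cfc Real.sqrt ρ)).trace =
          ((Lᴴ * cfc Real.sqrt ω * Vᴴ)ᴴ * (Lᴴ * cfc Real.sqrt ρ)).trace := by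
        simp only [conjTranspose_mul, conjTranspose_conjTranspose, cfc_isHermitian, Matrix.mul_assoc]
      rw [he, ← hn ω hω.nonneg, ← hn ρ hρ.nonneg]
      refine (Complex.re_le_norm _).trans ((norm_trace_le _ _).trans ?_)
      refine mul_le_mul_of_nonneg_right (hsNorm_mul_le _ ?_) (hsNorm_nonneg _)
      rw [conjTranspose_conjTranspose]
      exact conjTranspose_mul_self_le_one hV
    have k1 := key Q hQ0 hQ1
    have k2 := key (1 - Q) (sub_nonneg.2 hQ1) (sub_le_self _ hQ0)
    have hsplit : (V * (cfc Real.sqrt ω * cfc Real.sqrt ρ)).trace.re =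
        (V * (cfc Real.sqrt ω * Q * cfc Real.sqrt ρ)).trace.re +
        (V * (cfc Real.sqrt ω * (1 - Q) * cfc Real.sqrt ρ)).trace.re := by
      rw [← Complex.add_re, ← trace_add]
      congr 2
      noncomm_ring
    have hcompl : ∀ τ : Matrix (Fin k → κ) (Fin k → κ) ℂ, IsState τ →
        ((1 - Q) * τ).trace.re = 1 - (Q * τ).trace.re := by
      intro τ hτ
      rw [Matrix.sub_mul, Matrix.one_mul, trace_sub, hτ.2, Complex.sub_re, Complex.one_re]
    have t1 := trace_mul_nonneg hQ0 hω.nonneg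
    have t2 := trace_mul_nonneg (sub_nonneg.2 hQ1) hρ.nonneg
    have t3 := trace_mul_nonneg (sub_nonneg.2 hQ1) hω.nonneg
    rw [hcompl _ hω, hcompl _ hρ] at k2
    rw [hcompl _ hω] at t3
    rw [hcompl _ hρ] at t2
    have r1 : Real.sqrt (Q * ρ).trace.re ≤ 1 := Real.sqrt_le_one.2 (by linarith)
    have r2 : Real.sqrt (1 - (Q * ω).trace.re) ≤ 1 := Real.sqrt_le_one.2 (by linarith)
    have r3 : Real.sqrt (1 - (Q * ρ).trace.re) ≤ s / 2 :=
      Real.sqrt_le_iff.2 ⟨by positivity, by nlinarith⟩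
    have r4 : s / 2 ≤ Real.sqrt (Q * ω).trace.re := by
      nlinarith [Real.sqrt_nonneg (Q * ω).trace.re, Real.sqrt_nonneg (1 - (Q * ρ).trace.re)]
    have r5 := Real.sq_sqrt t1
    nlinarith

end Distance

/-! ### Multiplicativity of tensor powers. -/

section TensorPower

variable {ι : Type*}

theorem tensorPower_conjTranspose (A : Matrix ι ι ℂ) (n : ℕ) :
    (tensorPower A n)ᴴ = tensorPower Aᴴ n := by
  ext i j
  simp [tensorPower, conjTranspose_apply]

theorem tensorPower_diagonal [DecidableEq ι] (d : ι → ℂ) (n : ℕ) :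
    tensorPower (diagonal d) n = diagonal fun x : Fin n → ι => ∏ k, d (x k) := by
  ext i j
  simp only [tensorPower, of_apply, diagonal_apply]
  split_ifs with h
  · simp [h]
  · obtain ⟨k, hk⟩ := Function.ne_iff.1 h
    exact Finset.prod_eq_zero (Finset.mem_univ k) (if_neg hk)

theorem tensorPower_one [DecidableEq ι] (n : ℕ) :
    tensorPower (1 : Matrix ι ι ℂ) n = 1 := by
  rw [← diagonal_one, tensorPower_diagonal]
  simp

variable [Fintype ι]

theorem tensorPower_mul (A B : Matrix ι ι ℂ) (n : ℕ) :
    tensorPower (A * B) n = tensorPower A n * tensorPower B n := by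
  ext i j
  simp only [tensorPower, of_apply, mul_apply, ← Finset.prod_mul_distrib]
  rw [Finset.prod_univ_sum, Fintype.piFinset_univ]

theorem trace_tensorPower (A : Matrix ι ι ℂ) (n : ℕ) :
    (tensorPower A n).trace = A.trace ^ n := by
  simp only [trace, diag_apply, tensorPower, of_apply]
  rw [Fintype.sum_pow]

theorem IsState.tensorPower [DecidableEq ι] {ρ : Matrix ι ι ℂ} (h : IsState ρ) (n : ℕ) :
    IsState (tensorPower ρ n) := by
  refine ⟨?_, by rw [trace_tensorPower, h.2, one_pow]⟩
  obtain ⟨L, rfl⟩ := exists_eq_mul_conjTranspose h.nonneg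
  rw [tensorPower_mul, ← tensorPower_conjTranspose]
  exact posSemidef_self_mul_conjTranspose _

end TensorPower

/-! ### Diagonalization and domination by full-rank states. -/

section Spectral

variable {ι : Type*} [Fintype ι] [DecidableEq ι]

theorem exists_spectral {A : Matrix ι ι ℂ} (hA : A.IsHermitian) :
    ∃ U : Matrix ι ι ℂ, U * Uᴴ = 1 ∧ Uᴴ * U = 1 ∧
      A = U * diagonal (fun i => (hA.eigenvalues i : ℂ)) * Uᴴ ∧
      ∀ f : ℝ → ℝ, cfc f A = U * diagonal (fun i => (f (hA.eigenvalues i) : ℂ)) * Uᴴ := by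
  refine ⟨hA.eigenvectorUnitary, ?_, ?_, ?_, fun f => ?_⟩
  · exact Unitary.coe_mul_star_self _
  · exact Unitary.coe_star_mul_self _
  · conv_lhs => rw [hA.spectral_theorem, Unitary.conjStarAlgAut_apply]
    rfl
  · rw [hA.cfc_eq, IsHermitian.cfc, Unitary.conjStarAlgAut_apply]
    rfl

theorem diagonal_mono {α : Type*} [DecidableEq α] {d e : α → ℝ} (h : ∀ i, d i ≤ e i) :
    (diagonal (fun i => (d i : ℂ)) : Matrix α α ℂ) ≤ diagonal fun i => (e i : ℂ) := by
  rw [le_iff, diagonal_sub, posSemidef_diagonal_iff]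
  intro i
  rw [← Complex.ofReal_sub]
  exact Complex.zero_le_real.2 (sub_nonneg.2 (h i))

theorem conj_smul_one {U : Matrix ι ι ℂ} (hU : U * Uᴴ = 1) (c : ℝ) :
    U * diagonal (fun _ => (c : ℂ)) * Uᴴ = (c : ℂ) • 1 := by
  rw [← smul_one_eq_diagonal, Matrix.mul_smul, Matrix.mul_one, Matrix.smul_mul, hU]

theorem smul_mono {α : Type*} {A B : Matrix α α ℂ} (h : A ≤ B) {c : ℝ} (hc : 0 ≤ c) :
    (c : ℂ) • A ≤ (c : ℂ) • B := by
  have := (le_iff.1 h).smul (Complex.zero_le_real.2 hc)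
  rwa [smul_sub, ← le_iff] at this

/-- A positive definite matrix, given by its diagonalization, dominates every Hermitian matrix up to
a constant. -/
theorem exists_le_smul_of_diagonalized {U : Matrix ι ι ℂ} (hU : U * Uᴴ = 1) {d : ι → ℝ}
    (hd : ∀ i, 0 < d i) {B : Matrix ι ι ℂ} (hB : B.IsHermitian) :
    ∃ t : ℝ, 0 ≤ t ∧ B ≤ (t : ℂ) • (U * diagonal (fun i => (d i : ℂ)) * Uᴴ) := by
  obtain ⟨W, hW, -, hBW, -⟩ := exists_spectral hB
  set s := ∑ i, (d i)⁻¹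
  set b := ∑ i, |hB.eigenvalues i|
  have hs : 0 ≤ s := Finset.sum_nonneg fun i _ => (inv_pos.2 (hd i)).le
  have hb : 0 ≤ b := Finset.sum_nonneg fun i _ => abs_nonneg _
  refine ⟨b * s, mul_nonneg hb hs, ?_⟩
  have h1 : B ≤ (b : ℂ) • 1 := by
    rw [← conj_smul_one hW, hBW]
    exact conj_le_conj (diagonal_mono fun i => (le_abs_self _).trans
      (Finset.single_le_sum (f := fun i => |hB.eigenvalues i|) (fun i _ => abs_nonneg _)
        (Finset.mem_univ i))) _
  have h2 : (1 : Matrix ι ι ℂ) ≤ (s : ℂ) • (U * diagonal (fun i => (d i : ℂ)) * Uᴴ) := by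
    have : (1 : Matrix ι ι ℂ) = U * diagonal (fun _ => ((1 : ℝ) : ℂ)) * Uᴴ := by
      rw [conj_smul_one hU, Complex.ofReal_one, one_smul]
    rw [this, ← Matrix.smul_mul, ← Matrix.mul_smul, ← diagonal_smul]
    have he : ((s : ℂ) • fun i => (d i : ℂ)) = fun i => ((s * d i : ℝ) : ℂ) := by
      ext i
      simp
    rw [he]
    refine conj_le_conj (diagonal_mono fun i => ?_) _
    rw [← inv_mul_cancel₀ (hd i).ne']
    exact mul_le_mul_of_nonneg_right (Finset.single_le_sum (f := fun i => (d i)⁻¹)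
      (fun i _ => (inv_pos.2 (hd i)).le) (Finset.mem_univ i)) (hd i).le
  rw [Complex.ofReal_mul, mul_smul]
  exact h1.trans (smul_mono h2 hb)

theorem tensorPower_diagonalized (U : Matrix ι ι ℂ) (d : ι → ℝ) (n : ℕ) :
    tensorPower (U * diagonal (fun i => (d i : ℂ)) * Uᴴ) n =
      tensorPower U n * diagonal (fun x => ((∏ k, d (x k) : ℝ) : ℂ)) * (tensorPower U n)ᴴ := by
  rw [tensorPower_mul, tensorPower_mul, tensorPower_diagonal, tensorPower_conjTranspose]
  simp

theorem tensorPower_mul_conjTranspose_eq_one {U : Matrix ι ι ℂ} (hU : U * Uᴴ = 1) (n : ℕ) :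
    tensorPower U n * (tensorPower U n)ᴴ = 1 := by
  rw [tensorPower_conjTranspose, ← tensorPower_mul, hU, tensorPower_one]

theorem tensorPower_conjTranspose_mul_eq_one {U : Matrix ι ι ℂ} (hU : Uᴴ * U = 1) (n : ℕ) :
    (tensorPower U n)ᴴ * tensorPower U n = 1 := by
  rw [tensorPower_conjTranspose, ← tensorPower_mul, hU, tensorPower_one]

/-- A crude domination constant, valid at each fixed block length without smoothing; it is enough to
bound the output length for fixed $n$. -/
theorem exists_le_smul_tensorPower {σ : Matrix ι ι ℂ} (hσ : σ.PosDef) (n : ℕ)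
    {B : Matrix (Fin n → ι) (Fin n → ι) ℂ} (hB : B.IsHermitian) :
    ∃ t : ℝ, 0 ≤ t ∧ B ≤ (t : ℂ) • tensorPower σ n := by
  obtain ⟨U, hU, -, hσU, -⟩ := exists_spectral hσ.isHermitian
  rw [hσU, tensorPower_diagonalized]
  exact exists_le_smul_of_diagonalized (tensorPower_mul_conjTranspose_eq_one hU n)
    (fun x => Finset.prod_pos fun k _ => hσ.eigenvalues_pos _) hB

theorem exists_le_smul {σ : Matrix ι ι ℂ} (hσ : σ.PosDef)
    {B : Matrix ι ι ℂ} (hB : B.IsHermitian) :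
    ∃ t : ℝ, 0 ≤ t ∧ B ≤ (t : ℂ) • σ := by
  obtain ⟨U, hU, -, hσU, -⟩ := exists_spectral hσ.isHermitian
  have := exists_le_smul_of_diagonalized hU (fun x => hσ.eigenvalues_pos x) hB
  rwa [← hσU] at this

end Spectral

/-! ### Classical weak law of large numbers. -/

section Typicality

variable {ι : Type*} [Fintype ι]

/-- Conditioning on the first letter drives the inductions for the first and second moments. -/
theorem sum_prod_cons (p : ι → ℝ) (n : ℕ) (F : (Fin (n + 1) → ι) → ℝ) :
    ∑ x : Fin (n + 1) → ι, (∏ k, p (x k)) * F x =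
      ∑ a, p a * ∑ x : Fin n → ι, (∏ k, p (x k)) * F (Fin.cons a x) := by
  rw [← (Fin.consEquiv fun _ => ι).sum_comp, Fintype.sum_prod_type]
  refine Finset.sum_congr rfl fun a _ => ?_
  rw [Finset.mul_sum]
  refine Finset.sum_congr rfl fun x _ => ?_
  simp [Fin.consEquiv, Fin.prod_univ_succ, mul_assoc]

theorem sum_prod_eq_one {p : ι → ℝ} (hp : ∑ i, p i = 1) (n : ℕ) :
    ∑ x : Fin n → ι, ∏ k, p (x k) = 1 := by
  rw [← Fintype.sum_pow, hp, one_pow]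

theorem sum_prod_mul_sum {p g : ι → ℝ} (hp : ∑ i, p i = 1) (hg : ∑ i, p i * g i = 0) (n : ℕ) :
    ∑ x : Fin n → ι, (∏ k, p (x k)) * ∑ k, g (x k) = 0 := by
  induction n with
  | zero => simp
  | succ n ih =>
    rw [sum_prod_cons]
    simp only [Fin.sum_univ_succ, Fin.cons_zero, Fin.cons_succ, mul_add, Finset.sum_add_distrib, ih,
      ← Finset.sum_mul, sum_prod_eq_one hp, hp]
    simpa using hg

/-- The variance of a sum of independent centred random variables. -/
theorem sum_prod_mul_sum_sq {p g : ι → ℝ} (hp : ∑ i, p i = 1) (hg : ∑ i, p i * g i = 0) (n : ℕ) :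
    ∑ x : Fin n → ι, (∏ k, p (x k)) * (∑ k, g (x k)) ^ 2 = n * ∑ i, p i * g i ^ 2 := by
  induction n with
  | zero => simp
  | succ n ih =>
    rw [sum_prod_cons]
    have h : ∀ a, ∑ x : Fin n → ι, (∏ k, p (x k)) *
        (∑ k, g ((Fin.cons a x : Fin (n + 1) → ι) k)) ^ 2 = g a ^ 2 + n * ∑ i, p i * g i ^ 2 := by
      intro a
      have e : ∀ x : Fin n → ι, (∏ k, p (x k)) *
          (∑ k, g ((Fin.cons a x : Fin (n + 1) → ι) k)) ^ 2 = (∏ k, p (x k)) * g a ^ 2 +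
          2 * g a * ((∏ k, p (x k)) * ∑ k, g (x k)) + (∏ k, p (x k)) * (∑ k, g (x k)) ^ 2 := by
        intro x
        simp only [Fin.sum_univ_succ, Fin.cons_zero, Fin.cons_succ]
        ring
      simp only [e, Finset.sum_add_distrib, ← Finset.mul_sum, ← Finset.sum_mul, ih,
        sum_prod_mul_sum hp hg, sum_prod_eq_one hp]
      ring
    simp only [h, mul_add, Finset.sum_add_distrib, ← Finset.sum_mul, hp]
    push_cast
    ring

/-- Weak law of large numbers: under `p^{⊗ n}` a product of the weights `μ` is close to
`2 ^ (n c)` on a set of probability near one. -/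
theorem eventually_typical {p μ : ι → ℝ} (hp0 : ∀ i, 0 ≤ p i) (hp : ∑ i, p i = 1)
    (hμ0 : ∀ i, 0 ≤ μ i) (hsupp : ∀ i, μ i = 0 → p i = 0) {δ η : ℝ} (hδ : 0 < δ) (hη : 0 < η) :
    ∀ᶠ n : ℕ in atTop, 1 - η ≤ ∑ x : Fin n → ι with
      (2 : ℝ) ^ (n * (∑ i, p i * Real.logb 2 (μ i) - δ)) ≤ ∏ k, μ (x k) ∧
      ∏ k, μ (x k) ≤ (2 : ℝ) ^ (n * (∑ i, p i * Real.logb 2 (μ i) + δ)), ∏ k, p (x k) := by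
  set c := ∑ i, p i * Real.logb 2 (μ i) with hc
  set g : ι → ℝ := fun i => Real.logb 2 (μ i) - c with hgdef
  have hg : ∑ i, p i * g i = 0 := by
    simp only [hgdef, mul_sub, Finset.sum_sub_distrib, ← Finset.sum_mul, hp, ← hc]
    ring
  set v := ∑ i, p i * g i ^ 2 with hv
  -- Chebyshev: the exceptional probability is at most $nv/(n\delta)^2$, hence at most $\eta$ for
  -- these $n$.
  filter_upwards [eventually_gt_atTop 0,
    tendsto_natCast_atTop_atTop.eventually_ge_atTop (v / (η * δ ^ 2))] with n hn0 hn
  have hnpos : (0 : ℝ) < n := by exact_mod_cast hn0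
  rw [← sum_prod_eq_one hp n, ← Finset.sum_filter_add_sum_filter_not Finset.univ (fun x : Fin n → ι =>
      (2 : ℝ) ^ (n * (c - δ)) ≤ ∏ k, μ (x k) ∧ ∏ k, μ (x k) ≤ (2 : ℝ) ^ (n * (c + δ)))]
  suffices h : ∑ x : Fin n → ι with ¬ ((2 : ℝ) ^ (n * (c - δ)) ≤ ∏ k, μ (x k) ∧
      ∏ k, μ (x k) ≤ (2 : ℝ) ^ (n * (c + δ))), ∏ k, p (x k) ≤ η by linarith
  have hp' : ∀ x : Fin n → ι, 0 ≤ ∏ k, p (x k) := fun x => Finset.prod_nonneg fun k _ => hp0 _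
  have hle : ∀ x : Fin n → ι, ¬ ((2 : ℝ) ^ (n * (c - δ)) ≤ ∏ k, μ (x k) ∧
      ∏ k, μ (x k) ≤ (2 : ℝ) ^ (n * (c + δ))) →
      (∏ k, p (x k)) * (n * δ) ^ 2 ≤ (∏ k, p (x k)) * (∑ k, g (x k)) ^ 2 := by
    intro x hx
    -- Null sequences are set aside because some $\mu(x_k)$ may vanish there, and `Real.logb 2 0 =
    -- 0` would break the product formula.
    by_cases h0 : ∏ k, p (x k) = 0
    · simp [h0]
    have hμx : ∀ k, 0 < μ (x k) := fun k => (hμ0 _).lt_of_ne' fun h =>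
      h0 (Finset.prod_eq_zero (Finset.mem_univ k) (hsupp _ h))
    refine mul_le_mul_of_nonneg_left ?_ (hp' x)
    have hprod : ∏ k, μ (x k) = (2 : ℝ) ^ (∑ k, g (x k) + n * c) := by
      have : ∑ k, g (x k) + n * c = Real.logb 2 (∏ k, μ (x k)) := by
        rw [Real.logb_prod _ _ fun k _ => (hμx k).ne']
        simp [hgdef]
      rw [this, Real.rpow_logb (by norm_num) (by norm_num) (Finset.prod_pos fun k _ => hμx k)]
    rw [hprod, Real.rpow_le_rpow_left_iff one_lt_two, Real.rpow_le_rpow_left_iff one_lt_two] at hx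
    rw [sq_le_sq, abs_of_pos (mul_pos hnpos hδ)]
    by_contra hcon
    rw [not_le, abs_lt] at hcon
    exact hx ⟨by linarith, by linarith⟩
  have hsum : (∑ x : Fin n → ι with ¬ ((2 : ℝ) ^ (n * (c - δ)) ≤ ∏ k, μ (x k) ∧
      ∏ k, μ (x k) ≤ (2 : ℝ) ^ (n * (c + δ))), ∏ k, p (x k)) * (n * δ) ^ 2 ≤ n * v := by
    rw [hv, ← sum_prod_mul_sum_sq hp hg, Finset.sum_mul]
    refine (Finset.sum_le_sum fun x hx => hle x (Finset.mem_filter.1 hx).2).trans ?_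
    exact Finset.sum_le_univ_sum_of_nonneg fun x => mul_nonneg (hp' x) (sq_nonneg _)
  rw [div_le_iff₀ (by positivity)] at hn
  have hpos : 0 < (n * δ) ^ 2 := by positivity
  refine le_of_mul_le_mul_right (hsum.trans ?_) hpos
  nlinarith

end Typicality

/-! ### Typical spectral projections. -/

section TypicalProjection

variable {ι : Type*} [Fintype ι] [DecidableEq ι]

/-- Spectral projections of `σ^{⊗ n}` which are typical for `ρ^{⊗ n}`. -/
theorem eventually_exists_typical_projection {ρ σ : Matrix ι ι ℂ} (hρ : IsState ρ)
    (hσ : IsState σ) {t : ℝ} (ht : ρ ≤ (t : ℂ) • σ) {δ η : ℝ} (hδ : 0 < δ) (hη : 0 < η) :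
    ∀ᶠ n : ℕ in atTop, ∃ P : Matrix (Fin n → ι) (Fin n → ι) ℂ, Pᴴ = P ∧ P * P = P ∧
      P * tensorPower σ n = tensorPower σ n * P ∧
      1 - η ≤ (P * tensorPower ρ n).trace.re ∧
      (((2 : ℝ) ^ (n * ((ρ * cfc (Real.logb 2) σ).trace.re - δ)) : ℝ) : ℂ) • P ≤
        tensorPower σ n * P ∧
      tensorPower σ n * P ≤
        (((2 : ℝ) ^ (n * ((ρ * cfc (Real.logb 2) σ).trace.re + δ)) : ℝ) : ℂ) • P := by
  obtain ⟨U, hU, hU', hσU, hlog⟩ := exists_spectral hσ.1.1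
  set μ := hσ.1.1.eigenvalues with hμ
  have hμ0 : ∀ i, 0 ≤ μ i := hσ.1.eigenvalues_nonneg
  -- In an eigenbasis of $\sigma$ only the diagonal $p$ of $\rho$ matters: every trace taken here is
  -- against a matrix diagonal in that basis, and the diagonal of $R^{\otimes n}$ is the product
  -- distribution of $p$.
  set R := Uᴴ * ρ * U with hR
  have hRpos : 0 ≤ R := by
    have := conj_le_conj hρ.nonneg Uᴴ
    simpa [conjTranspose_conjTranspose] using this
  set p : ι → ℝ := fun i => (R i i).re with hpdef
  have hRp : ∀ i, R i i = (p i : ℂ) := by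
    intro i
    have := (nonneg_iff_posSemidef.1 hRpos).diag_nonneg (i := i)
    exact Complex.eq_re_of_ofReal_le (r := 0) (by simpa using this)
  have hp0 : ∀ i, 0 ≤ p i := fun i =>
    (Complex.le_def.1 (nonneg_iff_posSemidef.1 hRpos).diag_nonneg).1
  have htrR : ∀ d : ι → ℝ, (ρ * (U * diagonal (fun i => (d i : ℂ)) * Uᴴ)).trace.re =
      ∑ i, p i * d i := by
    intro d
    have : (ρ * (U * diagonal (fun i => (d i : ℂ)) * Uᴴ)).trace =
        (R * diagonal (fun i => (d i : ℂ))).trace := by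
      rw [hR, ← Matrix.mul_assoc, trace_mul_comm]
      simp only [Matrix.mul_assoc]
    rw [this]
    simp [trace, mul_diagonal, hRp]
  have hp1 : ∑ i, p i = 1 := by
    have := htrR fun _ => 1
    rw [conj_smul_one hU] at this
    simpa [hρ.2] using this.symm
  have hsupp : ∀ i, μ i = 0 → p i = 0 := by
    intro i hi
    have h1 := conj_le_conj ht Uᴴ
    rw [conjTranspose_conjTranspose, ← hR] at h1
    have h2 : Uᴴ * ((t : ℂ) • σ) * U = (t : ℂ) • diagonal (fun i => (μ i : ℂ)) := by
      rw [Matrix.mul_smul, Matrix.smul_mul, hσU]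
      congr 1
      calc Uᴴ * (U * diagonal (fun i => (μ i : ℂ)) * Uᴴ) * U
          = (Uᴴ * U) * diagonal (fun i => (μ i : ℂ)) * (Uᴴ * U) := by simp only [Matrix.mul_assoc]
        _ = _ := by rw [hU', Matrix.one_mul, Matrix.mul_one]
    rw [h2] at h1
    have h3 := (le_iff.1 h1).diag_nonneg (i := i)
    rw [Matrix.sub_apply, Matrix.smul_apply, diagonal_apply_eq, hi, hRp] at h3
    have h4 := (Complex.le_def.1 h3).1
    simp at h4
    exact le_antisymm h4 (hp0 i)
  have hc : (ρ * cfc (Real.logb 2) σ).trace.re = ∑ i, p i * Real.logb 2 (μ i) := by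
    rw [hlog, htrR]
  rw [hc]
  filter_upwards [eventually_typical hp0 hp1 hμ0 hsupp hδ hη] with n hn
  set a := (2 : ℝ) ^ (n * (∑ i, p i * Real.logb 2 (μ i) - δ))
  set b := (2 : ℝ) ^ (n * (∑ i, p i * Real.logb 2 (μ i) + δ))
  set χ : (Fin n → ι) → ℝ := fun x =>
    if a ≤ ∏ k, μ (x k) ∧ ∏ k, μ (x k) ≤ b then 1 else 0 with hχ
  set V := tensorPower U n with hV
  have hVV : V * Vᴴ = 1 := tensorPower_mul_conjTranspose_eq_one hU n
  have hVV' : Vᴴ * V = 1 := tensorPower_conjTranspose_mul_eq_one hU' n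
  have hmul : ∀ d e : (Fin n → ι) → ℝ, (V * diagonal (fun x => (d x : ℂ)) * Vᴴ) *
      (V * diagonal (fun x => (e x : ℂ)) * Vᴴ) = V * diagonal (fun x => ((d x * e x : ℝ) : ℂ)) * Vᴴ := by
    intro d e
    calc _ = V * diagonal (fun x => (d x : ℂ)) * (Vᴴ * V) * diagonal (fun x => (e x : ℂ)) * Vᴴ := by
          simp only [Matrix.mul_assoc]
      _ = _ := by
          rw [hVV', Matrix.mul_one, Matrix.mul_assoc V, diagonal_mul_diagonal]
          simp
  have hsmul : ∀ (s : ℝ) (d : (Fin n → ι) → ℝ), (s : ℂ) • (V * diagonal (fun x => (d x : ℂ)) * Vᴴ) =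
      V * diagonal (fun x => ((s * d x : ℝ) : ℂ)) * Vᴴ := by
    intro s d
    rw [← Matrix.smul_mul, ← Matrix.mul_smul, ← diagonal_smul]
    congr 3
    ext x
    simp
  have hσn : tensorPower σ n = V * diagonal (fun x => ((∏ k, μ (x k) : ℝ) : ℂ)) * Vᴴ := by
    rw [hσU, tensorPower_diagonalized]
  refine ⟨V * diagonal (fun x => (χ x : ℂ)) * Vᴴ, ?_, ?_, ?_, ?_, ?_, ?_⟩
  · simp only [conjTranspose_mul, conjTranspose_conjTranspose, diagonal_conjTranspose,
      Matrix.mul_assoc]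
    congr 3
    ext x
    simp
  · rw [hmul]
    congr 4
    ext x
    simp [hχ]
  · rw [hσn, hmul, hmul]
    simp only [mul_comm]
  · have h1 : (V * diagonal (fun x => (χ x : ℂ)) * Vᴴ * tensorPower ρ n).trace =
        (tensorPower R n * diagonal (fun x => (χ x : ℂ))).trace := by
      rw [hR, tensorPower_mul, tensorPower_mul, ← tensorPower_conjTranspose, ← hV, trace_mul_comm,
        ← Matrix.mul_assoc, trace_mul_comm]
      simp only [Matrix.mul_assoc]
    have h2 : (tensorPower R n * diagonal (fun x => (χ x : ℂ))).trace.re =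
        ∑ x : Fin n → ι, (∏ k, p (x k)) * χ x := by
      simp only [trace, diag_apply, mul_diagonal, tensorPower, of_apply, hRp]
      rw [Complex.re_sum]
      refine Finset.sum_congr rfl fun x _ => ?_
      rw [← Complex.ofReal_prod, ← Complex.ofReal_mul, Complex.ofReal_re]
    rw [h1, h2]
    simpa [hχ, Finset.sum_filter] using hn
  · rw [hσn, hmul, hsmul]
    refine conj_le_conj (diagonal_mono fun x => ?_) _
    simp only [hχ]
    split_ifs with h
    · simpa using h.1
    · simp
  · rw [hσn, hmul, hsmul]
    refine conj_le_conj (diagonal_mono fun x => ?_) _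
    simp only [hχ]
    split_ifs with h
    · simpa using h.2
    · simp

end TypicalProjection

/-! ### Klein's inequality. -/

section Klein

variable {ι : Type*} [Fintype ι] [DecidableEq ι]

/-- This is $\log u\le u-1$ at $u=y/x$, strict unless $u=1$; at $x=0$ only $y>0$ remains. -/
theorem mul_log_sub_nonneg {x y : ℝ} (hx : 0 ≤ x) (hy : 0 < y) :
    0 ≤ x * Real.log x - x * Real.log y - x + y ∧
      (x * Real.log x - x * Real.log y - x + y = 0 → x = y) := by
  rcases hx.eq_or_lt with rfl | hx
  · simp only [zero_mul, sub_self, zero_add]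
    exact ⟨hy.le, fun h => h.symm⟩
  have e : x * Real.log x - x * Real.log y - x + y = x * (y / x - 1 - Real.log (y / x)) := by
    rw [Real.log_div hy.ne' hx.ne']
    field_simp
    ring
  rw [e]
  refine ⟨mul_nonneg hx.le (sub_nonneg.2 (Real.log_le_sub_one_of_pos (by positivity))), fun h => ?_⟩
  by_contra hne
  have h1 : y / x ≠ 1 := fun h1 => hne ((div_eq_one_iff_eq hx.ne').1 h1).symm
  have h2 := mul_pos hx (sub_pos.2 (Real.log_lt_sub_one_of_pos (div_pos hy hx) h1))
  exact h2.ne' h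

/-- Klein's inequality, with its equality case. -/
theorem relativeEntropy_nonneg_and_eq {ρ σ : Matrix ι ι ℂ} (hρ : IsState ρ) (hσ : IsState σ)
    (hσ' : σ.PosDef) :
    0 ≤ relativeEntropy ρ σ ∧ (relativeEntropy ρ σ = 0 → ρ = σ) := by
  obtain ⟨U, hU, hU', hρU, hρlog⟩ := exists_spectral hρ.1.1
  obtain ⟨V, hV, hV', hσV, hσlog⟩ := exists_spectral hσ.1.1
  set lam := hρ.1.1.eigenvalues with hlam
  set μ := hσ.1.1.eigenvalues with hμ
  have hlam0 : ∀ i, 0 ≤ lam i := hρ.1.eigenvalues_nonneg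
  have hμ0 : ∀ i, 0 < μ i := hσ'.eigenvalues_pos
  set W := Uᴴ * V with hW
  have hWh : Wᴴ = Vᴴ * U := by rw [hW, conjTranspose_mul, conjTranspose_conjTranspose]
  have hWW : W * Wᴴ = 1 := by
    rw [hWh, hW, Matrix.mul_assoc, ← Matrix.mul_assoc V, hV, Matrix.one_mul, hU']
  have hWW' : Wᴴ * W = 1 := by
    rw [hWh, hW, Matrix.mul_assoc, ← Matrix.mul_assoc U, hU, Matrix.one_mul, hV']
  -- The squared overlaps of the eigenbases form a doubly stochastic matrix, reducing relative
  -- entropy to a weighted sum over pairs of eigenvalues.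
  set w : ι → ι → ℝ := fun i j => Complex.normSq (W i j) with hw
  have hwr : ∀ i, ∑ j, w i j = 1 := by
    intro i
    have := congrFun (congrFun hWW i) i
    simp only [mul_apply, conjTranspose_apply, one_apply_eq, RCLike.star_def, Complex.mul_conj] at this
    exact_mod_cast this
  have hwc : ∀ j, ∑ i, w i j = 1 := by
    intro j
    have := congrFun (congrFun hWW' j) j
    simp only [mul_apply, conjTranspose_apply, one_apply_eq, RCLike.star_def,
      ← Complex.normSq_eq_conj_mul_self] at this
    exact_mod_cast this
  have htr : ∀ d : ι → ℝ, (ρ * (V * diagonal (fun i => (d i : ℂ)) * Vᴴ)).trace.re =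
      ∑ i, ∑ j, w i j * (lam i * d j) := by
    intro d
    have : (ρ * (V * diagonal (fun i => (d i : ℂ)) * Vᴴ)).trace =
        (diagonal (fun i => (lam i : ℂ)) * (W * diagonal (fun i => (d i : ℂ)) * Wᴴ)).trace := by
      rw [hWh, hW, hρU, Matrix.mul_assoc U, Matrix.mul_assoc U, trace_mul_comm]
      simp only [Matrix.mul_assoc]
    rw [this]
    simp only [trace, diag_apply, diagonal_mul, Complex.re_sum]
    refine Finset.sum_congr rfl fun i _ => ?_
    rw [mul_apply, Finset.mul_sum, Complex.re_sum]
    refine Finset.sum_congr rfl fun j _ => ?_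
    rw [mul_diagonal, conjTranspose_apply]
    have : (lam i : ℂ) * (W i j * (d j : ℂ) * star (W i j)) = ((w i j * (lam i * d j) : ℝ) : ℂ) := by
      have h := Complex.mul_conj (W i j)
      rw [hw]
      push_cast
      rw [← h, RCLike.star_def]
      ring
    rw [this, Complex.ofReal_re]
  have htr' : (ρ * cfc (Real.logb 2) ρ).trace.re =
      ∑ i, ∑ j, w i j * (lam i * Real.logb 2 (lam i)) := by
    have : (ρ * cfc (Real.logb 2) ρ).trace = (diagonal (fun i => (lam i : ℂ)) *
        diagonal (fun i => (Real.logb 2 (lam i) : ℂ))).trace := by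
      rw [hρlog]
      nth_rewrite 1 [hρU]
      rw [Matrix.mul_assoc U, Matrix.mul_assoc U, trace_mul_comm]
      calc _ = (diagonal (fun i => (lam i : ℂ)) * (Uᴴ * U) *
            diagonal (fun i => (Real.logb 2 (lam i) : ℂ)) * (Uᴴ * U)).trace := by
            simp only [Matrix.mul_assoc]
        _ = _ := by rw [hU', Matrix.mul_one, Matrix.mul_one]
    rw [this, diagonal_mul_diagonal, trace_diagonal, Complex.re_sum]
    refine Finset.sum_congr rfl fun i _ => ?_
    rw [← Finset.sum_mul, hwr, one_mul, ← Complex.ofReal_mul, Complex.ofReal_re]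
  -- Both traces are one, so adding this zero sum makes each term nonnegative.
  have hsum : ∑ i, ∑ j, w i j * (μ j - lam i) = 0 := by
    have h1 : ∑ i, lam i = 1 := by
      rw [← Complex.ofReal_inj, Complex.ofReal_sum, Complex.ofReal_one]
      exact hρ.1.1.trace_eq_sum_eigenvalues.symm.trans hρ.2
    have h2 : ∑ i, μ i = 1 := by
      rw [← Complex.ofReal_inj, Complex.ofReal_sum, Complex.ofReal_one]
      exact hσ.1.1.trace_eq_sum_eigenvalues.symm.trans hσ.2
    simp only [mul_sub, Finset.sum_sub_distrib, ← Finset.sum_mul, hwr]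
    rw [Finset.sum_comm]
    simp [← Finset.sum_mul, hwc, h1, h2]
  have hD : relativeEntropy ρ σ = (∑ i, ∑ j, w i j *
      (lam i * Real.log (lam i) - lam i * Real.log (μ j) - lam i + μ j)) / Real.log 2 := by
    rw [relativeEntropy, Matrix.mul_sub, trace_sub, Complex.sub_re, htr', hσlog, htr,
      eq_div_iff (Real.log_pos one_lt_two).ne', ← sub_eq_zero]
    rw [sub_mul, Finset.sum_mul, Finset.sum_mul]
    rw [← neg_eq_zero, ← hsum]
    simp only [Finset.sum_mul, ← Finset.sum_sub_distrib, ← Finset.sum_neg_distrib]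
    refine Finset.sum_congr rfl fun i _ => Finset.sum_congr rfl fun j _ => ?_
    have := (Real.log_pos one_lt_two).ne'
    simp only [Real.logb]
    field_simp
    ring
  have hterm : ∀ i j, 0 ≤ w i j *
      (lam i * Real.log (lam i) - lam i * Real.log (μ j) - lam i + μ j) := fun i j =>
    mul_nonneg (Complex.normSq_nonneg _) (mul_log_sub_nonneg (hlam0 i) (hμ0 j)).1
  refine ⟨?_, fun h0 => ?_⟩
  · rw [hD]
    exact div_nonneg (Finset.sum_nonneg fun i _ => Finset.sum_nonneg fun j _ => hterm i j)
      (Real.log_pos one_lt_two).le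
  · rw [hD, div_eq_zero_iff, or_iff_left (Real.log_pos one_lt_two).ne',
      Finset.sum_eq_zero_iff_of_nonneg fun i _ => Finset.sum_nonneg fun j _ => hterm i j] at h0
    -- When all terms vanish, a nonzero overlap forces equal eigenvalues, so $W$ intertwines the two
    -- spectra.
    have hcomm : diagonal (fun i => (lam i : ℂ)) * W = W * diagonal (fun i => (μ i : ℂ)) := by
      ext i j
      rw [diagonal_mul, mul_diagonal, mul_comm]
      have hij := (Finset.sum_eq_zero_iff_of_nonneg fun j _ => hterm i j).1
        (h0 i (Finset.mem_univ i)) j (Finset.mem_univ j)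
      rcases mul_eq_zero.1 hij with h | h
      · rw [Complex.normSq_eq_zero.1 h, zero_mul, zero_mul]
      · rw [(mul_log_sub_nonneg (hlam0 i) (hμ0 j)).2 h]
    calc ρ = U * (diagonal (fun i => (lam i : ℂ)) * W) * Vᴴ := by
          rw [hW, Matrix.mul_assoc, Matrix.mul_assoc, Matrix.mul_assoc, hV, Matrix.mul_one,
            ← Matrix.mul_assoc]
          exact hρU
      _ = σ := by
          rw [hcomm, hW, ← Matrix.mul_assoc, ← Matrix.mul_assoc, hU, Matrix.one_mul]
          exact hσV.symm

end Klein

/-! ### Projections and gentle measurement. -/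

section Projection

variable {m : Type*} [Fintype m]

theorem projection_nonneg {P : Matrix m m ℂ} (hP : Pᴴ = P) (hPP : P * P = P) : 0 ≤ P := by
  have := self_mul_conjTranspose_nonneg P
  rwa [hP, hPP] at this

theorem projection_le_one [DecidableEq m] {P : Matrix m m ℂ} (hP : Pᴴ = P) (hPP : P * P = P) : P ≤ 1 := by
  have h1 : (1 - P)ᴴ = 1 - P := by rw [conjTranspose_sub, conjTranspose_one, hP]
  refine sub_nonneg.1 (projection_nonneg h1 ?_)
  simp only [Matrix.mul_sub, Matrix.sub_mul, Matrix.mul_one, Matrix.one_mul, hPP]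
  abel

theorem hsNorm_projection_mul_le [DecidableEq m] {P : Matrix m m ℂ} (hP : Pᴴ = P) (hPP : P * P = P)
    (X : Matrix m m ℂ) : hsNorm (P * X) ≤ hsNorm X := by
  have := hsNorm_conjTranspose_mul_le (V := P) (by rw [hP, hPP]; exact projection_le_one hP hPP) X
  rwa [hP] at this

/-- Gentle measurement. -/
theorem hsNorm_sub_projection_mul_le {P L : Matrix m m ℂ} (hP : Pᴴ = P) (hPP : P * P = P)
    (hL : IsState (L * Lᴴ)) {η : ℝ} (h : 1 - η ≤ (P * (L * Lᴴ)).trace.re) :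
    hsNorm (L - P * L) ≤ Real.sqrt η := by
  refine Real.le_sqrt_of_sq_le ?_
  have e : hsNorm (P * L) ^ 2 = (P * (L * Lᴴ)).trace.re := by
    rw [hsNorm_sq, conjTranspose_mul, hP, Matrix.mul_assoc, ← Matrix.mul_assoc P, hPP, trace_mul_comm,
      Matrix.mul_assoc]
  have e' : (Lᴴ * (P * L)).trace.re = (P * (L * Lᴴ)).trace.re := by
    rw [trace_mul_comm, Matrix.mul_assoc]
  rw [hsNorm_sub_sq, e, e', hL.hsNorm_eq_one]
  linarith

theorem hsNorm_sub_two_projections_le [DecidableEq m] {P P' L : Matrix m m ℂ} (hP : Pᴴ = P) (hPP : P * P = P)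
    (hP' : P'ᴴ = P') (hPP' : P' * P' = P') (hL : IsState (L * Lᴴ)) {η : ℝ}
    (h : 1 - η ≤ (P * (L * Lᴴ)).trace.re) (h' : 1 - η ≤ (P' * (L * Lᴴ)).trace.re) :
    hsNorm (L - P * (P' * L)) ≤ 2 * Real.sqrt η := by
  have e : L - P * (P' * L) = (L - P * L) + P * (L - P' * L) := by
    rw [Matrix.mul_sub]
    abel
  rw [e]
  have h1 := hsNorm_add_le (L - P * L) (P * (L - P' * L))
  have h2 := hsNorm_projection_mul_le hP hPP (L - P' * L)
  have h3 := hsNorm_sub_projection_mul_le hP hPP hL h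
  have h4 := hsNorm_sub_projection_mul_le hP' hPP' hL h'
  linarith

end Projection

/-! ### Stein's lemma and smoothed domination. -/

section Stein

variable {ι : Type*} [Fintype ι] [DecidableEq ι]

theorem two_rpow_pos (x : ℝ) : 0 < (2 : ℝ) ^ x := Real.rpow_pos_of_pos two_pos x

theorem relativeEntropy_eq_sub (ρ σ : Matrix ι ι ℂ) : relativeEntropy ρ σ =
    (ρ * cfc (Real.logb 2) ρ).trace.re - (ρ * cfc (Real.logb 2) σ).trace.re := by
  rw [relativeEntropy, Matrix.mul_sub, trace_sub, Complex.sub_re]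

/-- Achievability in quantum Stein's lemma. -/
theorem eventually_exists_test {ρ σ : Matrix ι ι ℂ} (hρ : IsState ρ) (hσ : IsState σ)
    (hσ' : σ.PosDef) {δ η : ℝ} (hδ : 0 < δ) (hη : 0 < η) :
    ∀ᶠ n : ℕ in atTop, ∃ Q : Matrix (Fin n → ι) (Fin n → ι) ℂ, 0 ≤ Q ∧ Q ≤ 1 ∧
      1 - η ≤ (Q * tensorPower ρ n).trace.re ∧
      (Q * tensorPower σ n).trace.re ≤ (2 : ℝ) ^ (-(n * (relativeEntropy ρ σ - δ))) := by
  obtain ⟨t, -, ht⟩ := exists_le_smul hσ' hρ.1.1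
  have ht1 : ρ ≤ ((1 : ℝ) : ℂ) • ρ := by simp
  -- Two gentle projections then move the purification by at most $\eta/2$, and
  -- $(1-\eta/2)^2\ge1-\eta$.
  have hη' : 0 < (η / 4) ^ 2 := by positivity
  filter_upwards [eventually_exists_typical_projection hρ hρ ht1 (half_pos hδ) hη',
    eventually_exists_typical_projection hρ hσ ht (half_pos hδ) hη']
    with n ⟨P, hP, hPP, hPc, hPρ, hPl, hPu⟩ ⟨R, hR, hRR, hRc, hRρ, hRl, hRu⟩
  have hρn := hρ.tensorPower n
  have hσn := hσ.tensorPower n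
  have hP0 := projection_nonneg hP hPP
  have hR0 := projection_nonneg hR hRR
  -- Here $P$ is $\rho$-typical of rank at most $2^{-n(a-\delta/2)}$, with
  -- $a=\mathrm{tr}\,\rho\log_2\rho$, and on $R$ the eigenvalues of $\sigma^{\otimes n}$ are at most
  -- $2^{n(c+\delta/2)}$, with $c=\mathrm{tr}\,\rho\log_2\sigma$. The product bounds the type II
  -- error.
  refine ⟨R * P * R, ?_, ?_, ?_, ?_⟩
  · have := conj_le_conj hP0 R
    rwa [hR, Matrix.mul_zero, Matrix.zero_mul] at this
  · have := conj_le_conj (projection_le_one hP hPP) R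
    rw [hR, Matrix.mul_one, hRR] at this
    exact this.trans (projection_le_one hR hRR)
  · obtain ⟨L, hL⟩ := exists_eq_mul_conjTranspose hρn.nonneg
    rw [hL] at hρn hPρ hRρ ⊢
    have h1 := hsNorm_sub_two_projections_le hP hPP hR hRR hρn hPρ hRρ
    have h2 := hsNorm_le_add_sub L (P * (R * L))
    rw [hρn.hsNorm_eq_one] at h2
    have h3 : (R * P * R * (L * Lᴴ)).trace.re = hsNorm (P * (R * L)) ^ 2 := by
      rw [hsNorm_sq', conjTranspose_mul, conjTranspose_mul, hP, hR]
      calc _ = (R * (P * P * R * L * Lᴴ)).trace.re := by rw [hPP]; simp only [Matrix.mul_assoc]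
        _ = ((P * P * R * L * Lᴴ) * R).trace.re := by rw [trace_mul_comm]
        _ = (P * (P * R * L * Lᴴ * R)).trace.re := by simp only [Matrix.mul_assoc]
        _ = ((P * R * L * Lᴴ * R) * P).trace.re := by rw [trace_mul_comm]
        _ = _ := by simp only [Matrix.mul_assoc]
    rw [h3]
    rw [Real.sqrt_sq (by positivity)] at h1
    by_cases hc : η ≤ 2
    · nlinarith [hsNorm_nonneg (P * (R * L))]
    · nlinarith [sq_nonneg (hsNorm (P * (R * L)))]
  · set a := (ρ * cfc (Real.logb 2) ρ).trace.re with ha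
    set c := (ρ * cfc (Real.logb 2) σ).trace.re with hc
    have h1 : (R * P * R * tensorPower σ n).trace.re = (P * (tensorPower σ n * R)).trace.re := by
      calc _ = (R * (P * R * tensorPower σ n)).trace.re := by simp only [Matrix.mul_assoc]
        _ = (P * (R * tensorPower σ n) * R).trace.re := by
          rw [trace_mul_comm]; simp only [Matrix.mul_assoc]
        _ = _ := by rw [hRc, Matrix.mul_assoc, Matrix.mul_assoc, hRR]
    have h2 := trace_mul_mono hP0 hRu
    have h3 : (P * R).trace.re ≤ P.trace.re := by
      simpa using trace_mul_mono hP0 (projection_le_one hR hRR)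
    have h4 := trace_re_mono hPl
    have h5 : (tensorPower ρ n * P).trace.re ≤ 1 := by
      have := trace_mul_mono hρn.nonneg (projection_le_one hP hPP)
      rwa [Matrix.mul_one, hρn.2, Complex.one_re] at this
    rw [Matrix.mul_smul, trace_smul, smul_eq_mul, Complex.re_ofReal_mul] at h2
    rw [trace_smul, smul_eq_mul, Complex.re_ofReal_mul] at h4
    rw [h1, relativeEntropy_eq_sub, ← ha, ← hc]
    have h6 : (2 : ℝ) ^ (-(n * (a - c - δ))) =
        (2 : ℝ) ^ (n * (c + δ / 2)) / (2 : ℝ) ^ (n * (a - δ / 2)) := by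
      rw [← Real.rpow_sub two_pos]
      congr 1
      ring
    rw [h6, le_div_iff₀ (two_rpow_pos _)]
    have p1 := two_rpow_pos (n * (c + δ / 2))
    have p2 := two_rpow_pos (n * (a - δ / 2))
    calc _ ≤ ((2 : ℝ) ^ (n * (c + δ / 2)) * P.trace.re) * (2 : ℝ) ^ (n * (a - δ / 2)) :=
          mul_le_mul_of_nonneg_right (h2.trans (mul_le_mul_of_nonneg_left h3 p1.le)) p2.le
      _ = (2 : ℝ) ^ (n * (c + δ / 2)) * ((2 : ℝ) ^ (n * (a - δ / 2)) * P.trace.re) := by ring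
      _ ≤ _ := mul_le_of_le_one_right p1.le (h4.trans h5)

/-- Asymptotic equipartition for the smooth max-relative entropy. -/
theorem eventually_exists_smoothing {ρ σ : Matrix ι ι ℂ} (hρ : IsState ρ) (hσ : IsState σ)
    (hσ' : σ.PosDef) {δ θ : ℝ} (hδ : 0 < δ) (hθ : 0 < θ) :
    ∀ᶠ n : ℕ in atTop, ∃ ω K L : Matrix (Fin n → ι) (Fin n → ι) ℂ, IsState ω ∧
      L * Lᴴ = tensorPower ρ n ∧ K * Kᴴ ≤ ω ∧ hsNorm (K - L) ≤ θ ∧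
      ω ≤ (((2 : ℝ) ^ (n * (relativeEntropy ρ σ + δ)) : ℝ) : ℂ) • tensorPower σ n := by
  obtain ⟨t, -, ht⟩ := exists_le_smul hσ' hρ.1.1
  have ht1 : ρ ≤ ((1 : ℝ) : ℂ) • ρ := by simp
  have hη : 0 < (θ / 2) ^ 2 := by positivity
  have hD := (relativeEntropy_nonneg_and_eq hρ hσ hσ').1
  have hδ3 : 0 < δ / 3 := by linarith
  filter_upwards [eventually_exists_typical_projection hρ hρ ht1 hδ3 hη,
    eventually_exists_typical_projection hρ hσ ht hδ3 hη,
    tendsto_natCast_atTop_atTop.eventually_ge_atTop (3 / δ)]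
    with n ⟨P, hP, hPP, hPc, hPρ, hPl, hPu⟩ ⟨R, hR, hRR, hRc, hRρ, hRl, hRu⟩ hn
  have hρn := hρ.tensorPower n
  have hσn := hσ.tensorPower n
  have hP0 := projection_nonneg hP hPP
  have hR0 := projection_nonneg hR hRR
  obtain ⟨L, hL⟩ := exists_eq_mul_conjTranspose hρn.nonneg
  have hLs : IsState (L * Lᴴ) := by rwa [← hL]
  -- $P$ caps the spectrum of $\rho^{\otimes n}$; compressing by $R$ afterwards places the result
  -- where $\sigma^{\otimes n}$ is bounded below.
  set K := R * (P * L) with hK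
  have hKK : K * Kᴴ = R * (tensorPower ρ n * P) * R := by
    rw [hK, conjTranspose_mul, conjTranspose_mul, hP, hR]
    calc _ = R * (P * (L * Lᴴ) * P) * R := by simp only [Matrix.mul_assoc]
      _ = _ := by rw [← hL, hPc, Matrix.mul_assoc _ P, hPP]
  have hKle : hsNorm K ≤ 1 := by
    rw [← hLs.hsNorm_eq_one]
    exact (hsNorm_projection_mul_le hR hRR _).trans (hsNorm_projection_mul_le hP hPP _)
  have hs : (K * Kᴴ).trace = ((hsNorm K ^ 2 : ℝ) : ℂ) := by
    rw [hsNorm_sq']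
    exact Complex.eq_re_of_ofReal_le (r := 0)
      (by simpa using (posSemidef_self_mul_conjTranspose K).trace_nonneg)
  have hs1 : 0 ≤ 1 - hsNorm K ^ 2 := by nlinarith [hsNorm_nonneg K]
  have hadd : 0 ≤ ((1 - hsNorm K ^ 2 : ℝ) : ℂ) • tensorPower σ n := by
    have := smul_mono hσn.nonneg hs1
    rwa [smul_zero] at this
  -- The lost trace is refilled with $\sigma^{\otimes n}$, raising the domination constant by at
  -- most $1$. The spare $\delta/3$ in the exponent absorbs this once $2^{n\delta/3}\ge2$.
  refine ⟨K * Kᴴ + ((1 - hsNorm K ^ 2 : ℝ) : ℂ) • tensorPower σ n, K, L, ⟨?_, ?_⟩, hL.symm, ?_, ?_, ?_⟩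
  · exact nonneg_iff_posSemidef.1 (add_nonneg (self_mul_conjTranspose_nonneg K) hadd)
  · rw [trace_add, trace_smul, hσn.2, hs, smul_eq_mul, mul_one]
    push_cast
    ring
  · exact le_add_of_nonneg_right hadd
  · rw [hsNorm_sub_rev]
    rw [hL] at hPρ hRρ
    have := hsNorm_sub_two_projections_le hR hRR hP hPP hLs hRρ hPρ
    rw [Real.sqrt_sq (by positivity)] at this
    linarith
  · set a := (ρ * cfc (Real.logb 2) ρ).trace.re with ha
    set c := (ρ * cfc (Real.logb 2) σ).trace.re with hc
    have p1 := two_rpow_pos (n * (a + δ / 3))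
    have p2 := two_rpow_pos (n * (c - δ / 3))
    have h1 : K * Kᴴ ≤ (((2 : ℝ) ^ (n * (a + δ / 3)) : ℝ) : ℂ) • R := by
      rw [hKK]
      have := conj_le_conj (hPu.trans (smul_mono (projection_le_one hP hPP) p1.le)) R
      rwa [hR, Matrix.mul_smul, Matrix.mul_one, Matrix.smul_mul, hRR] at this
    have h2 : tensorPower σ n * R ≤ tensorPower σ n := by
      have hh : (1 - R)ᴴ = 1 - R := by rw [conjTranspose_sub, conjTranspose_one, hR]
      have := conj_le_conj hσn.nonneg (1 - R)
      rw [hh, Matrix.mul_zero, Matrix.zero_mul] at this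
      rw [← sub_nonneg]
      convert this using 1
      rw [Matrix.sub_mul, Matrix.one_mul, hRc, Matrix.sub_mul, Matrix.mul_sub, Matrix.mul_sub,
        Matrix.mul_assoc _ R (R : Matrix (Fin n → ι) (Fin n → ι) ℂ), hRR]
      simp
    have h3 := smul_mono (hRl.trans h2) (c := (2 : ℝ) ^ (n * (a + δ / 3)) / (2 : ℝ) ^ (n * (c - δ / 3)))
      (by positivity)
    rw [smul_smul, ← Complex.ofReal_mul, div_mul_cancel₀ _ p2.ne'] at h3
    have h4 : (2 : ℝ) ^ (n * (a + δ / 3)) / (2 : ℝ) ^ (n * (c - δ / 3)) + (1 - hsNorm K ^ 2) ≤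
        (2 : ℝ) ^ (n * (relativeEntropy ρ σ + δ)) := by
      rw [relativeEntropy_eq_sub, ← ha, ← hc] at hD ⊢
      rw [← Real.rpow_sub two_pos]
      have e1 : n * (a + δ / 3) - n * (c - δ / 3) = n * (a - c + 2 * δ / 3) := by ring
      have e2 : (n : ℝ) * (a - c + δ) = n * (a - c + 2 * δ / 3) + n * (δ / 3) := by ring
      rw [e1, e2, Real.rpow_add two_pos]
      have hnd : 1 ≤ (n : ℝ) * (δ / 3) := by
        rw [div_le_iff₀ hδ] at hn
        linarith
      have q1 : (2 : ℝ) ≤ (2 : ℝ) ^ ((n : ℝ) * (δ / 3)) := by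
        simpa using Real.rpow_le_rpow_of_exponent_le one_le_two hnd
      have q2 : (1 : ℝ) ≤ (2 : ℝ) ^ (n * (a - c + 2 * δ / 3)) :=
        Real.one_le_rpow one_le_two (by positivity)
      nlinarith [sq_nonneg (hsNorm K)]
    calc K * Kᴴ + ((1 - hsNorm K ^ 2 : ℝ) : ℂ) • tensorPower σ n
        ≤ (((2 : ℝ) ^ (n * (a + δ / 3)) / (2 : ℝ) ^ (n * (c - δ / 3)) : ℝ) : ℂ) • tensorPower σ n +
          ((1 - hsNorm K ^ 2 : ℝ) : ℂ) • tensorPower σ n := by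
          gcongr
          exact h1.trans h3
      _ = ((((2 : ℝ) ^ (n * (a + δ / 3)) / (2 : ℝ) ^ (n * (c - δ / 3)) + (1 - hsNorm K ^ 2)) : ℝ) : ℂ) •
          tensorPower σ n := by
          rw [← add_smul, Complex.ofReal_add]
      _ ≤ _ := by
          have := smul_mono hσn.nonneg (sub_nonneg.2 h4)
          rw [smul_zero, Complex.ofReal_sub, sub_smul] at this
          exact sub_nonneg.1 this

end Stein

/-! ### Channels and measure-and-prepare maps. -/

section Channels

variable {ι κ : Type*} [Fintype ι] [Fintype κ]

theorem trace_eq_ofReal {A : Matrix ι ι ℂ} (hA : 0 ≤ A) : A.trace = (A.trace.re : ℂ) :=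
  Complex.eq_re_of_ofReal_le (r := 0) (by simpa using (nonneg_iff_posSemidef.1 hA).trace_nonneg)

theorem IsChannel.nonneg {Φ : Matrix ι ι ℂ →ₗ[ℂ] Matrix κ κ ℂ} (hΦ : IsChannel Φ)
    {X : Matrix ι ι ℂ} (hX : 0 ≤ X) : 0 ≤ Φ X := by
  have := hΦ.completely_positive 1 _ ((nonneg_iff_posSemidef.1 hX).submatrix Prod.fst)
  exact nonneg_iff_posSemidef.2 (this.submatrix fun a => (a, 0))

theorem IsChannel.mono {Φ : Matrix ι ι ℂ →ₗ[ℂ] Matrix κ κ ℂ} (hΦ : IsChannel Φ)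
    {X Y : Matrix ι ι ℂ} (h : X ≤ Y) : Φ X ≤ Φ Y := by
  have := hΦ.nonneg (sub_nonneg.2 h)
  rwa [map_sub, sub_nonneg] at this

theorem IsChannel.isState {Φ : Matrix ι ι ℂ →ₗ[ℂ] Matrix κ κ ℂ} (hΦ : IsChannel Φ)
    {ρ : Matrix ι ι ℂ} (hρ : IsState ρ) : IsState (Φ ρ) :=
  ⟨nonneg_iff_posSemidef.1 (hΦ.nonneg (nonneg_iff_posSemidef.2 hρ.1)),
    by rw [hΦ.trace_preserving, hρ.2]⟩

variable [DecidableEq ι]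

theorem trace_mul_eq_ofReal {A B : Matrix ι ι ℂ} (hA : 0 ≤ A) (hB : 0 ≤ B) :
    (A * B).trace = ((A * B).trace.re : ℂ) := by
  obtain ⟨L, rfl⟩ := exists_eq_mul_conjTranspose hB
  have := conj_le_conj hA Lᴴ
  rw [conjTranspose_conjTranspose, Matrix.mul_zero, Matrix.zero_mul] at this
  rw [← Matrix.mul_assoc, trace_mul_comm, ← Matrix.mul_assoc]
  exact trace_eq_ofReal this

/-- The effect `Q` applied to the first tensor factor leaves a positive operator on the second. -/
theorem posSemidef_partial_trace_mul {Q : Matrix ι ι ℂ} (hQ : 0 ≤ Q) {k : ℕ}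
    {X : Matrix (ι × Fin k) (ι × Fin k) ℂ} (hX : X.PosSemidef) :
    (of fun b b' : Fin k => (Q * of fun i j => X (i, b) (j, b')).trace).PosSemidef := by
  obtain ⟨B, rfl⟩ := exists_eq_mul_conjTranspose hQ
  -- The Kraus operators $\langle b_l|\otimes 1$, with $b_l$ the columns of $B$.
  set C : ι → Matrix (Fin k) (ι × Fin k) ℂ := fun l =>
    of fun b p => if b = p.2 then star (B p.1 l) else 0 with hC
  have : (of fun b b' : Fin k => (B * Bᴴ * of fun i j => X (i, b) (j, b')).trace) =
      ∑ l, C l * X * (C l)ᴴ := by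
    ext b b'
    rw [Matrix.sum_apply, of_apply, Matrix.mul_assoc, trace_mul_comm]
    simp only [trace, diag_apply, hC, mul_apply, of_apply, conjTranspose_apply, Fintype.sum_prod_type]
    refine Finset.sum_congr rfl fun l _ => Finset.sum_congr rfl fun j _ => ?_
    rw [Finset.sum_eq_single b' (fun x _ hx => by simp [Ne.symm hx]) (by simp)]
    simp
  rw [this]
  exact posSemidef_sum _ fun l _ => hX.mul_mul_conjTranspose_same _

/-- Measure the test `Q`, then prepare `ω` or `τ` according to the outcome. -/
noncomputable def measurePrepare (Q : Matrix ι ι ℂ) (ω τ : Matrix κ κ ℂ) :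
    Matrix ι ι ℂ →ₗ[ℂ] Matrix κ κ ℂ :=
  (traceLinearMap ι ℂ ℂ ∘ₗ LinearMap.mulLeft ℂ Q).smulRight ω +
    (traceLinearMap ι ℂ ℂ ∘ₗ LinearMap.mulLeft ℂ (1 - Q)).smulRight τ

theorem measurePrepare_apply {α : Type*} (Q : Matrix ι ι ℂ) (ω τ : Matrix α α ℂ) (X : Matrix ι ι ℂ) :
    measurePrepare Q ω τ X = (Q * X).trace • ω + ((1 - Q) * X).trace • τ := rfl

/-- The ampliation is a sum of two Kronecker products of a prepared state with a positive partial
trace, hence positive. -/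
theorem isChannel_measurePrepare {Q : Matrix ι ι ℂ} (hQ0 : 0 ≤ Q) (hQ1 : Q ≤ 1)
    {ω τ : Matrix κ κ ℂ} (hω : IsState ω) (hτ : IsState τ) :
    IsChannel (measurePrepare Q ω τ) := by
  refine ⟨fun k X hX => ?_, fun X => ?_⟩
  · have h1 := hω.1.kronecker (posSemidef_partial_trace_mul hQ0 hX)
    have h2 := hτ.1.kronecker (posSemidef_partial_trace_mul (sub_nonneg.2 hQ1) hX)
    suffices e : ampliation (measurePrepare Q ω τ) k X =
        kroneckerMap (fun x y => x * y) ω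
          (of fun b b' : Fin k => (Q * of fun i j => X (i, b) (j, b')).trace) +
        kroneckerMap (fun x y => x * y) τ
          (of fun b b' : Fin k => ((1 - Q) * of fun i j => X (i, b) (j, b')).trace) by
      rw [e]
      exact h1.add h2
    ext a b
    simp only [ampliation, measurePrepare_apply, of_apply, Matrix.add_apply, Matrix.smul_apply,
      smul_eq_mul, kroneckerMap_apply]
    ring
  · rw [measurePrepare_apply, trace_add, trace_smul, trace_smul, hω.2, hτ.2, Matrix.sub_mul, trace_sub,
      Matrix.one_mul]
    simp

end Channels

/-! ### One-shot achievability and converse. -/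

section OneShot

variable {ι : Type*} [Fintype ι] [DecidableEq ι] {κ : Type} [Fintype κ] [DecidableEq κ]
  {ρ₁ σ₁ : Matrix ι ι ℂ} {ρ₂ σ₂ : Matrix κ κ ℂ} {n m : ℕ} {ε : ℝ}

/-- The channel that discards its input and prepares $\sigma_2^{\otimes m}$ suffices. This covers
both $m=0$ and $\rho_2=\sigma_2$. -/
theorem achievable_of_eq (Δ : ErrorMetric) (hρ₁ : IsState ρ₁) (hσ₁ : IsState σ₁)
    (hσ₂ : IsState σ₂) (n : ℕ) (h : tensorPower ρ₂ m = tensorPower σ₂ m) (hε : 0 ≤ ε) :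
    Achievable Δ ρ₁ σ₁ ρ₂ σ₂ n m ε := by
  have hσm := hσ₂.tensorPower m
  have hΦ : ∀ τ : Matrix (Fin n → ι) (Fin n → ι) ℂ, IsState τ →
      measurePrepare 1 (tensorPower σ₂ m) (tensorPower σ₂ m) τ = tensorPower σ₂ m := by
    intro τ hτ
    simp [measurePrepare_apply, hτ.2]
  refine ⟨_, isChannel_measurePrepare (nonneg_iff_posSemidef.2 .one) le_rfl hσm hσm, hΦ _ (hσ₁.tensorPower n), ?_⟩
  rw [hΦ _ (hρ₁.tensorPower n), h]
  exact (distance_self Δ hσm).trans hε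

/-- A test for the input and a smoothing of the target combine to a measure-and-prepare channel. -/
theorem achievable_of_test (Δ : ErrorMetric) (hρ₁ : IsState ρ₁) (hσ₁ : IsState σ₁)
    (hρ₂ : IsState ρ₂) (hσ₂ : IsState σ₂) (hε₀ : 0 < ε) (hε₁ : ε < 1)
    {Q : Matrix (Fin n → ι) (Fin n → ι) ℂ} (hQ0 : 0 ≤ Q) (hQ1 : Q ≤ 1)
    (hQρ : 1 - ε ^ 2 / 4 ≤ (Q * tensorPower ρ₁ n).trace.re)
    {p M : ℝ} (hQσ : (Q * tensorPower σ₁ n).trace.re ≤ p) (hp : p < 1) (hpM : p * M ≤ 1) (hM : 0 ≤ M)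
    {ω K L : Matrix (Fin m → κ) (Fin m → κ) ℂ} (hω : IsState ω) (hL : L * Lᴴ = tensorPower ρ₂ m)
    (hK : K * Kᴴ ≤ ω) (hKL : hsNorm (K - L) ≤ ε ^ 2 / 4)
    (hωσ : ω ≤ (M : ℂ) • tensorPower σ₂ m) : Achievable Δ ρ₁ σ₁ ρ₂ σ₂ n m ε := by
  have hρn := hρ₁.tensorPower n
  have hσn := hσ₁.tensorPower n
  have hρm := hρ₂.tensorPower m
  have hσm := hσ₂.tensorPower m
  set s := (Q * tensorPower σ₁ n).trace.re with hs
  set q := (Q * tensorPower ρ₁ n).trace.re with hq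
  have hs0 : 0 ≤ s := trace_mul_nonneg hQ0 hσn.nonneg
  have hs1 : 0 < 1 - s := by linarith
  have hq0 : 0 ≤ q := trace_mul_nonneg hQ0 hρn.nonneg
  have hq1 : q ≤ 1 := by
    have := trace_mul_mono hρn.nonneg hQ1
    rwa [Matrix.mul_one, hρn.2, Complex.one_re, trace_mul_comm] at this
  have hsQ : (Q * tensorPower σ₁ n).trace = (s : ℂ) := trace_mul_eq_ofReal hQ0 hσn.nonneg
  have hqQ : (Q * tensorPower ρ₁ n).trace = (q : ℂ) := trace_mul_eq_ofReal hQ0 hρn.nonneg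
  have hrest : (s : ℂ) • ω ≤ tensorPower σ₂ m := by
    have h1 := smul_mono hωσ hs0
    have h2 := smul_mono hσm.nonneg (c := 1 - s * M) (by nlinarith)
    rw [smul_smul, ← Complex.ofReal_mul] at h1
    rw [smul_zero, Complex.ofReal_sub, sub_smul, Complex.ofReal_one, one_smul, sub_nonneg] at h2
    exact h1.trans h2
  -- The solution of $s\omega+(1-s)\tau=\sigma_2^{\otimes m}$; it is positive since $s\omega\le
  -- sM\sigma_2^{\otimes m}$ and $sM\le1$.
  set τ := (((1 - s)⁻¹ : ℝ) : ℂ) • (tensorPower σ₂ m - (s : ℂ) • ω) with hτdef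
  have hτ0 : 0 ≤ τ := by
    have := smul_mono (sub_nonneg.2 hrest) (inv_pos.2 hs1).le
    rwa [smul_zero] at this
  have hτ : IsState τ := by
    refine ⟨nonneg_iff_posSemidef.1 hτ0, ?_⟩
    rw [hτdef, trace_smul, trace_sub, trace_smul, hσm.2, hω.2, smul_eq_mul, smul_eq_mul, mul_one,
      ← Complex.ofReal_one, ← Complex.ofReal_sub, ← Complex.ofReal_mul, inv_mul_cancel₀ hs1.ne']
  have hΦ := isChannel_measurePrepare hQ0 hQ1 hω hτ
  refine ⟨_, hΦ, ?_, ?_⟩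
  · rw [measurePrepare_apply, Matrix.sub_mul, Matrix.one_mul, trace_sub, hσn.2, hsQ, hτdef, smul_smul,
      ← Complex.ofReal_one, ← Complex.ofReal_sub, ← Complex.ofReal_mul, mul_inv_cancel₀ hs1.ne',
      Complex.ofReal_one, one_smul]
    abel
  · have hdom : (((Real.sqrt q : ℝ) : ℂ) • K) * (((Real.sqrt q : ℝ) : ℂ) • K)ᴴ ≤
        measurePrepare Q ω τ (tensorPower ρ₁ n) := by
      have h1 : (((Real.sqrt q : ℝ) : ℂ) • K) * (((Real.sqrt q : ℝ) : ℂ) • K)ᴴ =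
          (q : ℂ) • (K * Kᴴ) := by
        rw [conjTranspose_smul, Matrix.smul_mul, Matrix.mul_smul, smul_smul, RCLike.star_def,
          Complex.conj_ofReal, ← Complex.ofReal_mul, Real.mul_self_sqrt hq0]
      rw [h1, measurePrepare_apply, Matrix.sub_mul, Matrix.one_mul, trace_sub, hρn.2, hqQ,
        ← Complex.ofReal_one, ← Complex.ofReal_sub]
      have h2 := smul_mono hτ0 (sub_nonneg.2 hq1)
      rw [smul_zero] at h2
      exact (smul_mono hK hq0).trans (le_add_of_nonneg_right h2)
    have hL1 : hsNorm L = 1 := IsState.hsNorm_eq_one (by rwa [hL])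
    have hsq : q ≤ Real.sqrt q := by
      nlinarith [Real.sq_sqrt hq0, Real.sqrt_nonneg q, Real.sqrt_le_one.2 hq1]
    -- Smoothing and $1-\sqrt q\le1-q$ each cost at most $\varepsilon^2/4$, so the final distance is
    -- at most $\sqrt{2\cdot\varepsilon^2/2}=\varepsilon$.
    have hclose : hsNorm (((Real.sqrt q : ℝ) : ℂ) • K - L) ≤ ε ^ 2 / 2 := by
      have e : ((Real.sqrt q : ℝ) : ℂ) • K - L = ((Real.sqrt q : ℝ) : ℂ) • (K - L) +
          ((Real.sqrt q - 1 : ℝ) : ℂ) • L := by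
        push_cast
        module
      rw [e]
      refine (hsNorm_add_le _ _).trans ?_
      have h1 := Real.sqrt_le_one.2 hq1
      rw [hsNorm_smul, hsNorm_smul, Complex.norm_real, Complex.norm_real, Real.norm_eq_abs,
        Real.norm_eq_abs, abs_of_nonneg (Real.sqrt_nonneg q), abs_of_nonpos (by linarith), hL1]
      nlinarith [Real.sqrt_nonneg q, hsNorm_nonneg (K - L)]
    refine (distance_le_of_dominates Δ (hΦ.isState hρn) hρm hdom hL (by nlinarith)).trans ?_
    exact Real.sqrt_le_iff.2 ⟨hε₀.le, by linarith⟩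

/-- The converse bound: pulling a test back through the channel. -/
theorem accept_le_of_achievable {Δ : ErrorMetric} (hρ₁ : IsState ρ₁) (hρ₂ : IsState ρ₂)
    (hach : Achievable Δ ρ₁ σ₁ ρ₂ σ₂ n m ε) {c η : ℝ}
    (hc : ∀ ω ρ Q : Matrix (Fin m → κ) (Fin m → κ) ℂ, IsState ω → IsState ρ → Δ.distance ω ρ ≤ ε →
      0 ≤ Q → Q ≤ 1 → 1 - η ≤ (Q * ρ).trace.re → c ≤ (Q * ω).trace.re)
    {Q : Matrix (Fin m → κ) (Fin m → κ) ℂ} (hQ0 : 0 ≤ Q) (hQ1 : Q ≤ 1)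
    (hQρ : 1 - η ≤ (Q * tensorPower ρ₂ m).trace.re)
    {ω K L : Matrix (Fin n → ι) (Fin n → ι) ℂ} (hL : L * Lᴴ = tensorPower ρ₁ n)
    (hK : K * Kᴴ ≤ ω) {M : ℝ} (hωσ : ω ≤ (M : ℂ) • tensorPower σ₁ n) :
    c ≤ 2 * (M * (Q * tensorPower σ₂ m).trace.re) + 2 * hsNorm (K - L) ^ 2 := by
  obtain ⟨Φ, hΦ, hσ, hd⟩ := hach
  have h1 := hc _ _ Q (hΦ.isState (hρ₁.tensorPower n)) (hρ₂.tensorPower m) hd hQ0 hQ1 hQρ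
  -- The gap is $(2K-L)(2K-L)^\dagger$. An operator inequality survives the channel, at the harmless
  -- price of a factor $2$.
  have h2 : L * Lᴴ ≤ (2 : ℂ) • (K * Kᴴ) + (2 : ℂ) • ((K - L) * (K - L)ᴴ) := by
    have := self_mul_conjTranspose_nonneg ((2 : ℂ) • K - L)
    rw [← sub_nonneg]
    convert this using 1
    simp only [conjTranspose_sub, conjTranspose_smul, Matrix.sub_mul, Matrix.mul_sub, Matrix.smul_mul,
      Matrix.mul_smul, star_ofNat]
    module
  have h3 := trace_mul_mono hQ0 (hΦ.mono h2)
  rw [hL, map_add, map_smul, map_smul, Matrix.mul_add, Matrix.mul_smul, Matrix.mul_smul, trace_add,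
    trace_smul, trace_smul] at h3
  have h4 := trace_mul_mono hQ0 (hΦ.mono (hK.trans hωσ))
  rw [map_smul, hσ, Matrix.mul_smul, trace_smul, smul_eq_mul, Complex.re_ofReal_mul] at h4
  have h5 : (Q * Φ ((K - L) * (K - L)ᴴ)).trace.re ≤ hsNorm (K - L) ^ 2 := by
    have := trace_mul_mono (hΦ.nonneg (self_mul_conjTranspose_nonneg (K - L))) hQ1
    rwa [Matrix.mul_one, hΦ.trace_preserving, ← hsNorm_sq', trace_mul_comm] at this
  simp only [smul_eq_mul, Complex.add_re, Complex.mul_re, Complex.re_ofNat, Complex.im_ofNat, zero_mul,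
    sub_zero] at h3
  linarith

end OneShot

/-! ### Asymptotic rates. -/

section Rates

variable {ι : Type*} [Fintype ι] [DecidableEq ι] {κ : Type} [Fintype κ] [DecidableEq κ]
  {ρ₁ σ₁ : Matrix ι ι ℂ} {ρ₂ σ₂ : Matrix κ κ ℂ} {ε : ℝ}

theorem achievable_zero (Δ : ErrorMetric) (hρ₁ : IsState ρ₁) (hσ₁ : IsState σ₁)
    (hσ₂ : IsState σ₂) (n : ℕ) (hε : 0 ≤ ε) : Achievable Δ ρ₁ σ₁ ρ₂ σ₂ n 0 ε :=
  achievable_of_eq Δ hρ₁ hσ₁ hσ₂ n (by ext i j; simp [tensorPower]) hε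

theorem tendsto_two_rpow_neg_mul {g : ℝ} (hg : 0 < g) :
    Tendsto (fun n : ℕ => (2 : ℝ) ^ (-(n * g))) atTop (𝓝 0) := by
  have h : ∀ n : ℕ, (2 : ℝ) ^ (-(n * g)) = ((2 : ℝ) ^ (-g)) ^ n := by
    intro n
    rw [← Real.rpow_mul_natCast two_pos.le]
    congr 1
    ring
  simp only [h]
  exact tendsto_pow_atTop_nhds_zero_of_lt_one (two_rpow_pos _).le
    (Real.rpow_lt_one_of_one_lt_of_neg one_lt_two (neg_lt_zero.2 hg))

/-- With $n$ fixed, the domination constant of $\rho_1^{\otimes n}$ by $\sigma_1^{\otimes n}$ is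
fixed, while the type II error of the output test decays exponentially in $m$. No smoothing is
needed, so $K=L$. -/
theorem eventually_not_achievable (Δ : ErrorMetric) (hρ₁ : IsState ρ₁) (hσ₁' : σ₁.PosDef)
    (hρ₂ : IsState ρ₂) (hσ₂ : IsState σ₂) (hσ₂' : σ₂.PosDef) (hε₀ : 0 < ε) (hε₁ : ε < 1)
    (hD : 0 < relativeEntropy ρ₂ σ₂) (n : ℕ) :
    ∀ᶠ m : ℕ in atTop, ¬ Achievable Δ ρ₁ σ₁ ρ₂ σ₂ n m ε := by
  obtain ⟨c, hc0, η, hη, hc⟩ := exists_accept_of_distance_le Δ hε₀ hε₁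
  obtain ⟨t, ht0, ht⟩ := exists_le_smul_tensorPower hσ₁' n (hρ₁.tensorPower n).1.1
  obtain ⟨L, hL⟩ := exists_eq_mul_conjTranspose (hρ₁.tensorPower n).nonneg
  have hlim := ((tendsto_two_rpow_neg_mul (half_pos hD)).const_mul (2 * t)).eventually_lt_const
    (by simpa using hc0)
  filter_upwards [hlim, eventually_exists_test hρ₂ hσ₂ hσ₂' (half_pos hD) hη]
    with m hm ⟨Q, hQ0, hQ1, hQρ, hQσ⟩ hach
  have := accept_le_of_achievable hρ₁ hρ₂ hach (hc m) hQ0 hQ1 hQρ hL.symm hL.ge ht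
  rw [hsNorm, hsVec_sub, sub_self, norm_zero] at this
  have h1 := mul_le_mul_of_nonneg_left hQσ ht0
  rw [sub_half] at h1
  linarith

theorem isGreatest_maxRate (Δ : ErrorMetric) (hρ₁ : IsState ρ₁) (hσ₁ : IsState σ₁)
    (hσ₁' : σ₁.PosDef) (hρ₂ : IsState ρ₂) (hσ₂ : IsState σ₂) (hσ₂' : σ₂.PosDef) (hε₀ : 0 < ε)
    (hε₁ : ε < 1) (hD : 0 < relativeEntropy ρ₂ σ₂) (n : ℕ) :
    IsGreatest (achievableRates Δ ρ₁ σ₁ ρ₂ σ₂ ε n) (maxRate Δ ρ₁ σ₁ ρ₂ σ₂ ε n) := by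
  obtain ⟨B, hB⟩ := eventually_atTop.1
    (eventually_not_achievable Δ hρ₁ hσ₁' hρ₂ hσ₂ hσ₂' hε₀ hε₁ hD n)
  have hbdd : BddAbove {m | Achievable Δ ρ₁ σ₁ ρ₂ σ₂ n m ε} :=
    ⟨B, fun m hm => le_of_not_ge fun h => hB m h hm⟩
  have hne : {m | Achievable Δ ρ₁ σ₁ ρ₂ σ₂ n m ε}.Nonempty :=
    ⟨0, achievable_zero Δ hρ₁ hσ₁ hσ₂ n hε₀.le⟩
  have hmax : IsGreatest (achievableRates Δ ρ₁ σ₁ ρ₂ σ₂ ε n)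
      (((sSup {m | Achievable Δ ρ₁ σ₁ ρ₂ σ₂ n m ε} : ℕ) / (n : ℝ) : ℝ) : EReal) := by
    refine ⟨⟨_, Nat.sSup_mem hne hbdd, rfl⟩, ?_⟩
    rintro _ ⟨m, hm, rfl⟩
    have : (m : ℝ) ≤ (sSup {m | Achievable Δ ρ₁ σ₁ ρ₂ σ₂ n m ε} : ℕ) :=
      Nat.cast_le.2 (le_csSup hbdd hm)
    exact EReal.coe_le_coe_iff.2 (div_le_div_of_nonneg_right this n.cast_nonneg)
  rwa [maxRate, hmax.isLUB.sSup_eq]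

theorem maxRate_eq_top (Δ : ErrorMetric) (hρ₁ : IsState ρ₁) (hσ₁ : IsState σ₁)
    (hσ₂ : IsState σ₂) (hε₀ : 0 < ε) {n : ℕ} (hn : 1 ≤ n) :
    maxRate Δ ρ₁ σ₁ σ₂ σ₂ ε n = ⊤ := by
  rw [maxRate, sSup_eq_top]
  intro b hb
  obtain ⟨x, hbx, -⟩ := EReal.lt_iff_exists_real_btwn.1 hb
  obtain ⟨m, hm⟩ := exists_nat_gt (x * n)
  refine ⟨_, ⟨m, achievable_of_eq Δ hρ₁ hσ₁ hσ₂ n rfl hε₀.le, rfl⟩, hbx.trans ?_⟩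
  rw [EReal.coe_lt_coe_iff, lt_div_iff₀ (by exact_mod_cast hn)]
  exact hm

theorem eventually_le_maxRate (Δ : ErrorMetric) (hρ₁ : IsState ρ₁) (hσ₁ : IsState σ₁)
    (hσ₁' : σ₁.PosDef) (hρ₂ : IsState ρ₂) (hσ₂ : IsState σ₂) (hσ₂' : σ₂.PosDef) (hε₀ : 0 < ε)
    (hε₁ : ε < 1) (hD : 0 < relativeEntropy ρ₂ σ₂) {r : ℝ}
    (hr : r < relativeEntropy ρ₁ σ₁ / relativeEntropy ρ₂ σ₂) :
    ∀ᶠ n : ℕ in atTop, (r : EReal) ≤ maxRate Δ ρ₁ σ₁ ρ₂ σ₂ ε n := by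
  set D₁ := relativeEntropy ρ₁ σ₁
  set D₂ := relativeEntropy ρ₂ σ₂
  -- Nonpositive rates are met by $m=0$; afterwards $r'>0$, so the output length tends to infinity
  -- and Stein's asymptotics apply to the target.
  rcases le_or_gt r 0 with hr0 | hr0
  · refine Eventually.of_forall fun n => le_trans ?_
      (le_sSup ⟨0, achievable_zero Δ hρ₁ hσ₁ hσ₂ n hε₀.le, rfl⟩)
    rw [EReal.coe_le_coe_iff]
    simpa using hr0
  obtain ⟨r', hrr', hr'⟩ := exists_between hr
  have hr'0 : 0 < r' := hr0.trans hrr'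
  rw [lt_div_iff₀ hD] at hr'
  -- Chosen so that $r'(D_2+\delta)=D_1-\delta$, balancing the type II error against the domination
  -- constant at $m\approx nr'$.
  set δ := (D₁ - r' * D₂) / (1 + r') with hδ
  have hδ0 : 0 < δ := div_pos (by linarith) (by linarith)
  have hδeq : δ * (1 + r') = D₁ - r' * D₂ := div_mul_cancel₀ _ (by linarith)
  have hδ1 : 0 < D₁ - δ := by nlinarith
  have hθ : 0 < ε ^ 2 / 4 := by positivity
  have hfloor : Tendsto (fun n : ℕ => ⌊(n : ℝ) * r'⌋₊) atTop atTop :=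
    tendsto_nat_floor_atTop.comp (tendsto_natCast_atTop_atTop.atTop_mul_const hr'0)
  filter_upwards [eventually_exists_test hρ₁ hσ₁ hσ₁' hδ0 hθ,
    hfloor.eventually (eventually_exists_smoothing hρ₂ hσ₂ hσ₂' hδ0 hθ), eventually_gt_atTop 0,
    -- The margin $n(r'-r)\ge1$ pays for the floor.
    tendsto_natCast_atTop_atTop.eventually_ge_atTop (1 / (r' - r))]
    with n ⟨Q, hQ0, hQ1, hQρ, hQσ⟩ ⟨ω, K, L, hω, hL, hK, hKL, hωσ⟩ hn0 hn
  have hnpos : (0 : ℝ) < n := by exact_mod_cast hn0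
  set m := ⌊(n : ℝ) * r'⌋₊
  have hm1 : (m : ℝ) ≤ n * r' := Nat.floor_le (by positivity)
  have hm2 : (n : ℝ) * r' < m + 1 := Nat.lt_floor_add_one _
  have hach : Achievable Δ ρ₁ σ₁ ρ₂ σ₂ n m ε := by
    refine achievable_of_test Δ hρ₁ hσ₁ hρ₂ hσ₂ hε₀ hε₁ hQ0 hQ1 hQρ hQσ ?_ ?_ (two_rpow_pos _).le hω hL
      hK hKL hωσ
    · exact Real.rpow_lt_one_of_one_lt_of_neg one_lt_two (neg_lt_zero.2 (mul_pos hnpos hδ1))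
    · rw [← Real.rpow_add two_pos]
      refine Real.rpow_le_one_of_one_le_of_nonpos one_le_two ?_
      have h1 := mul_le_mul_of_nonneg_right hm1 (add_pos hD hδ0).le
      have h2 : (n : ℝ) * r' * (D₂ + δ) = n * (D₁ - δ) := by
        linear_combination (n : ℝ) * hδeq
      change -(n * (D₁ - δ)) + m * (D₂ + δ) ≤ 0
      linarith
  refine le_trans ?_ (le_sSup ⟨m, hach, rfl⟩)
  rw [EReal.coe_le_coe_iff, le_div_iff₀ hnpos]
  rw [div_le_iff₀ (sub_pos.2 hrr')] at hn
  nlinarith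

theorem eventually_maxRate_le (Δ : ErrorMetric) (hρ₁ : IsState ρ₁) (hσ₁ : IsState σ₁)
    (hσ₁' : σ₁.PosDef) (hρ₂ : IsState ρ₂) (hσ₂ : IsState σ₂) (hσ₂' : σ₂.PosDef) (hε₀ : 0 < ε)
    (hε₁ : ε < 1) (hD : 0 < relativeEntropy ρ₂ σ₂) {r : ℝ}
    (hr : relativeEntropy ρ₁ σ₁ / relativeEntropy ρ₂ σ₂ < r) :
    ∀ᶠ n : ℕ in atTop, maxRate Δ ρ₁ σ₁ ρ₂ σ₂ ε n ≤ (r : EReal) := by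
  have hD₁ := (relativeEntropy_nonneg_and_eq hρ₁ hσ₁ hσ₁').1
  set D₁ := relativeEntropy ρ₁ σ₁ with hD₁def
  set D₂ := relativeEntropy ρ₂ σ₂ with hD₂def
  have hr0 : 0 < r := (div_nonneg hD₁ hD.le).trans_lt hr
  rw [div_lt_iff₀ hD] at hr
  obtain ⟨c, hc0, η, hη, hc⟩ := exists_accept_of_distance_le Δ hε₀ hε₁
  -- Half of the exponent gap is spent on the slack $\delta(1+r)=g$; the other half leaves a decay
  -- $2^{-ng}$.
  set g := (r * D₂ - D₁) / 2 with hg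
  have hg0 : 0 < g := by rw [hg]; linarith
  set δ := g / (1 + r) with hδ
  have hδ0 : 0 < δ := div_pos hg0 (by linarith)
  have hδeq : δ * (1 + r) = g := div_mul_cancel₀ _ (by linarith)
  have hδ2 : 0 < D₂ - δ := by nlinarith
  -- The smoothing term is then at most $2\cdot c/4$ and the exponential term is below $2\cdot c/4$,
  -- contradicting acceptance at least $c$.
  have hθ : 0 < Real.sqrt c / 2 := by positivity
  obtain ⟨m₀, hm₀⟩ := eventually_atTop.1 (eventually_exists_test hρ₂ hσ₂ hσ₂' hδ0 hη)
  have hlim := (tendsto_two_rpow_neg_mul hg0).eventually_lt_const (show 0 < c / 4 by linarith)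
  filter_upwards [eventually_exists_smoothing hρ₁ hσ₁ hσ₁' hδ0 hθ, hlim, eventually_gt_atTop 0,
    tendsto_natCast_atTop_atTop.eventually_ge_atTop (m₀ / r)]
    with n ⟨ω, K, L, hω, hL, hK, hKL, hωσ⟩ hn hn0 hnm
  have hnpos : (0 : ℝ) < n := by exact_mod_cast hn0
  refine sSup_le ?_
  rintro _ ⟨m, hm, rfl⟩
  rw [EReal.coe_le_coe_iff, div_le_iff₀ hnpos]
  by_contra hcon
  rw [not_le] at hcon
  rw [div_le_iff₀ hr0] at hnm
  -- The output test must exist for every $m>rn$ at once, since $m$ is not a function of $n$ here.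
  have hmm : m₀ ≤ m := by
    have : (m₀ : ℝ) ≤ m := by linarith
    exact_mod_cast this
  obtain ⟨Q, hQ0, hQ1, hQρ, hQσ⟩ := hm₀ m hmm
  have h1 := accept_le_of_achievable hρ₁ hρ₂ hm (hc m) hQ0 hQ1 hQρ hL hK hωσ
  have h2 := mul_le_mul_of_nonneg_left hQσ (two_rpow_pos (n * (D₁ + δ))).le
  rw [← Real.rpow_add two_pos] at h2
  have h3 : (2 : ℝ) ^ (n * (D₁ + δ) + -(m * (D₂ - δ))) ≤ (2 : ℝ) ^ (-(n * g)) := by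
    refine Real.rpow_le_rpow_of_exponent_le one_le_two ?_
    have h4 := mul_le_mul_of_nonneg_right hcon.le hδ2.le
    have h5 : (n : ℝ) * (D₁ + δ) - r * n * (D₂ - δ) = -(n * g) := by
      linear_combination (n : ℝ) * hδeq - (2 * n : ℝ) * hg
    linarith
  have h6 : hsNorm (K - L) ^ 2 ≤ c / 4 := by
    have := pow_le_pow_left₀ (hsNorm_nonneg _) hKL 2
    rw [div_pow, Real.sq_sqrt hc0.le] at this
    linarith
  rw [← hD₁def] at h1
  rw [← hD₂def] at h2
  linarith

end Rates

end QDichotomy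

theorem mainTheorem1 (d₁ d₂ : ℕ)
    (ρ₁ σ₁ : Matrix (Fin d₁) (Fin d₁) ℂ) (ρ₂ σ₂ : Matrix (Fin d₂) (Fin d₂) ℂ)
    (hρ₁ : QDichotomy.IsState ρ₁) (hσ₁ : QDichotomy.IsState σ₁)
    (hρ₂ : QDichotomy.IsState ρ₂) (hσ₂ : QDichotomy.IsState σ₂)
    (hσ₁_full : σ₁.PosDef) (hσ₂_full : σ₂.PosDef)
    (Δ : QDichotomy.ErrorMetric) (ε : ℝ) (hε₀ : 0 < ε) (hε₁ : ε < 1) :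
    (QDichotomy.relativeEntropy ρ₂ σ₂ ≠ 0 →
      (∀ n : ℕ, 1 ≤ n →
        IsGreatest (QDichotomy.achievableRates Δ ρ₁ σ₁ ρ₂ σ₂ ε n)
          (QDichotomy.maxRate Δ ρ₁ σ₁ ρ₂ σ₂ ε n)) ∧
      Tendsto (fun n : ℕ => QDichotomy.maxRate Δ ρ₁ σ₁ ρ₂ σ₂ ε n) atTop
        (𝓝 ((QDichotomy.relativeEntropy ρ₁ σ₁ / QDichotomy.relativeEntropy ρ₂ σ₂ : ℝ) : EReal))) ∧
    (QDichotomy.relativeEntropy ρ₂ σ₂ = 0 →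
      ∀ n : ℕ, 1 ≤ n → QDichotomy.maxRate Δ ρ₁ σ₁ ρ₂ σ₂ ε n = ⊤) := by
  refine ⟨fun hD => ?_, fun hD n hn => ?_⟩
  · have hD' := lt_of_le_of_ne
      (QDichotomy.relativeEntropy_nonneg_and_eq hρ₂ hσ₂ hσ₂_full).1 hD.symm
    refine ⟨fun n _ => QDichotomy.isGreatest_maxRate Δ hρ₁ hσ₁ hσ₁_full hρ₂ hσ₂ hσ₂_full hε₀ hε₁ hD' n,
      tendsto_order.2 ⟨fun a ha => ?_, fun a ha => ?_⟩⟩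
    · obtain ⟨r, har, hr⟩ := EReal.lt_iff_exists_real_btwn.1 ha
      filter_upwards [QDichotomy.eventually_le_maxRate Δ hρ₁ hσ₁ hσ₁_full hρ₂ hσ₂ hσ₂_full hε₀ hε₁ hD'
        (EReal.coe_lt_coe_iff.1 hr)] with n hn
      exact har.trans_le hn
    · obtain ⟨r, hr, hra⟩ := EReal.lt_iff_exists_real_btwn.1 ha
      filter_upwards [QDichotomy.eventually_maxRate_le Δ hρ₁ hσ₁ hσ₁_full hρ₂ hσ₂ hσ₂_full hε₀ hε₁ hD'
        (EReal.coe_lt_coe_iff.1 hr)] with n hn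
      exact hn.trans_lt hra
  · obtain rfl := (QDichotomy.relativeEntropy_nonneg_and_eq hρ₂ hσ₂ hσ₂_full).2 hD
    exact QDichotomy.maxRate_eq_top Δ hρ₁ hσ₁ hσ₂ hε₀ hn
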